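/- Let $\mathbb{F}_q$ be a finite field with $q$ elements, let $n\ge 1$ and $d\ge 2$ be integers, and let $X\subset\mathbb{P}^{n+1}$ be a hypersurface of degree $d$ over $\mathbb{F}_q$, i.e. the zero locus of a nonzero homogeneous polynomial $F\in\mathbb{F}_q[X_0,\dots,X_{n+1}]$ of degree $d$. Write $N_q(Y)$ for the number of $\mathbb{F}_q$-rational points of $Y$; in particular $N_q(\mathbb{P}^{n-1})=q^{n-1}+\dots+q+1$. Suppose that $X$ contains no line defined over $\mathbb{F}_q$ (i.e. $F$ does not vanish identically on any such line). Then $$N_q(X)\le (d-1)q^n+(d-2)N_q(\mathbb{P}^{n-1})+1 .$$ Equality holds if and only if $d=2$ and, up to projective equivalence over $\mathbb{F}_q$ (an invertible $\mathbb{F}_q$-linear change of coordinates and multiplication of $F$ by a nonzero constant), one of the following holds: (1) $n=1$ and $X$ is the plane conic $X_0^2+X_1^2+X_2^2=0$ if $q$ is odd, respectively $X_0X_1+X_2^2=0$ if $q$ is even; (2) $n=2$ and $X$ is an elliptic quadric surface $f(X_0,X_1)+X_2X_3=0$, where $f(X_0,X_1)=\alpha X_0^2+X_0X_1+X_1^2$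 and $\alpha\in\mathbb{F}_q$ satisfies $\alpha+\alpha^2+\alpha^4+\dots+\alpha^{2^{r-1}}=1$ if $q=2^r$, respectively $1-4\alpha$ is a non-square in $\mathbb{F}_q$ if $q$ is odd. Moreover, whenever equality holds $X$ is nonsingular (over the algebraic closure), and for every $\alpha$ as in (2) the binary form $f$ is irreducible over $\mathbb{F}_q$. -/

import Mathlib

open scoped LinearAlgebra.Projectivization

noncomputable section

namespace Hypersurface

variable {K : Type*} [Field K]

/-- The set `X(K)` of `K`-rational points of the projective hypersurface `X : F = 0`. -/
def rationalPoints {m : ℕ} (F : MvPolynomial (Fin m) K) : Set (ℙ K (Fin m → K)) :=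
  {P | ∀ v ∈ P.submodule, MvPolynomial.eval v F = 0}

/-- The number `N_q(X)` of `K`-rational points of the hypersurface `X : F = 0`. -/
def numPoints {m : ℕ} (F : MvPolynomial (Fin m) K) : ℕ :=
  (rationalPoints F).ncard

/-- The `K`-linear subspace `ℙ(W)` is contained in the hypersurface `F = 0` as an algebraic set,
that is, `F` vanishes at all points of `ℙ(W)` over the algebraic closure of `K` (and not only
at the `K`-rational ones). -/
def ContainsSubspace {m : ℕ} (F : MvPolynomial (Fin m) K) (W : Submodule K (Fin m → K)) : Prop :=
  ∀ x ∈ Submodule.span (AlgebraicClosure K)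
      ((fun (v : Fin m → K) (i : Fin m) => algebraMap K (AlgebraicClosure K) (v i)) ''
        (W : Set (Fin m → K))),
    MvPolynomial.aeval x F = 0

/-- The hypersurface `F = 0` contains a line defined over `K`. -/
def ContainsLine {m : ℕ} (F : MvPolynomial (Fin m) K) : Prop :=
  ∃ W : Submodule K (Fin m → K), Module.finrank K W = 2 ∧ ContainsSubspace F W

/-- The hypersurface `F = 0` is nonsingular (over the algebraic closure). -/
def IsNonsingular {m : ℕ} (F : MvPolynomial (Fin m) K) : Prop :=
  ∀ x : Fin m → AlgebraicClosure K, x ≠ 0 → MvPolynomial.aeval x F = 0 →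
    ∃ i, MvPolynomial.aeval x (MvPolynomial.pderiv i F) ≠ 0

/-- Projective equivalence over `K` of the hypersurfaces `F = 0` and `G = 0`: an invertible
`K`-linear change of coordinates carries `G` to a nonzero multiple of `F`. The numbers `m`, `m'`
of variables are necessarily equal; two names avoid casts between `Fin (n + 2)` and `Fin 3`
or `Fin 4`. -/
def ProjEquiv {m m' : ℕ} (F : MvPolynomial (Fin m) K) (G : MvPolynomial (Fin m') K) : Prop :=
  ∃ (A : (Fin m → K) ≃ₗ[K] (Fin m' → K)) (c : K), c ≠ 0 ∧
    MvPolynomial.bind₁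
      (fun j : Fin m' => ∑ i : Fin m,
        MvPolynomial.C (A (Pi.single i 1) j) * (MvPolynomial.X i : MvPolynomial (Fin m) K)) G =
      MvPolynomial.C c * F

variable (K) in
/-- `X₀² + X₁² + X₂²`. -/
def sumSqConic : MvPolynomial (Fin 3) K :=
  MvPolynomial.X 0 ^ 2 + MvPolynomial.X 1 ^ 2 + MvPolynomial.X 2 ^ 2

variable (K) in
/-- `X₀X₁ + X₂²`. -/
def hypConic : MvPolynomial (Fin 3) K :=
  MvPolynomial.X 0 * MvPolynomial.X 1 + MvPolynomial.X 2 ^ 2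

/-- The binary quadratic form `αX₀² + X₀X₁ + X₁²`. -/
def binaryForm (α : K) : MvPolynomial (Fin 2) K :=
  MvPolynomial.C α * MvPolynomial.X 0 ^ 2 + MvPolynomial.X 0 * MvPolynomial.X 1
    + MvPolynomial.X 1 ^ 2

/-- The quaternary quadratic form `f(X₀, X₁) + X₂X₃` with `f = αX₀² + X₀X₁ + X₁²`. -/
def ellipticForm (α : K) : MvPolynomial (Fin 4) K :=
  MvPolynomial.rename (Fin.castLE (by omega)) (binaryForm α)
    + MvPolynomial.X 2 * MvPolynomial.X 3

/-- The condition on `α`: if `q = 2 ^ r`, then `α + α² + α⁴ + ⋯ + α^(2^(r-1)) = 1`;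
if `q` is odd, then `1 - 4α` is a non-square. -/
def IsEllipticParam [Fintype K] (α : K) : Prop :=
  (∀ r : ℕ, Fintype.card K = 2 ^ r → ∑ i ∈ Finset.range r, α ^ 2 ^ i = 1) ∧
  (Odd (Fintype.card K) → ¬ IsSquare (1 - 4 * α))

end Hypersurface

end

/-! Points of hypersurfaces without lines over finite fields. -/

noncomputable section

namespace Hypersurface

open MvPolynomial

variable {K : Type*} [Field K]

/-! Fix a rational point `x` of `X` and restrict `F` to the lines through it. Since `X` contains no
line, `F(Tx + y)` is a nonzero polynomial in `T` for every `y` outside the span of `x`. Its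
coefficient at `T^d` is `F(x) = 0`, and the next one is `polar F x y`. Hence it has at most `d - 1`
zeros, and at most `d - 2` if `y` lies in the tangent hyperplane. Summing over all vectors `y`
counts each affine zero of `F` exactly `q` times and yields the bound, strictly if `x` is singular
(`numPoints_lt_pointBound_of_polar_eq_zero`). For nonsingular `x`, equality means that every line
through `x` attains its own bound (`numPoints_eq_pointBound_iff`).

If equality holds with `d ≥ 3`, a tangent line at `x` contains a further rational point `y` of `X`.
Counting on this line from `y` forces tangency at `y` as well, and the resulting double zero leaves
one zero too few (`degree_eq_two_of_eq`).

For `d = 2`, a nonsingular point `e` belongs to a hyperbolic pair `e, f`. The form is anisotropic on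
the orthogonal complement, since a zero there would span a line of `X` with `e`. By
Chevalley–Warning `n ≤ 2` (`dim_le_two_of_quadric`), and normalizing the anisotropic part gives the
two models. Conversely, a model has a nonsingular rational point, and for a quadric this alone
forces equality (`numPoints_eq_of_quadric`). -/

/-! ### Restriction of a form to a line -/

/-- The chain rule for a derivation applied to a polynomial expression. -/
lemma derivation_aeval {σ A : Type*} [Fintype σ] [CommRing A] [Algebra K A]
    (D : Derivation K A A) (g : σ → A) (G : MvPolynomial σ K) :
    D (aeval g G) = ∑ j, aeval g (pderiv j G) * D (g j) := by
  induction G using MvPolynomial.induction_on with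
  | C a => simp
  | add p q hp hq => simp [hp, hq, add_mul, Finset.sum_add_distrib]
  | mul_X p i hp =>
    classical
    simp only [map_mul, aeval_X, Derivation.leibniz, hp, smul_eq_mul, pderiv_X, map_add,
      add_mul, Finset.sum_add_distrib, Finset.mul_sum]
    congr 1
    · rw [Finset.sum_eq_single i]
      · simp
      · intro j _ hj
        simp [hj.symm]
      · simp
    · exact Finset.sum_congr rfl fun j _ => by ring

/-- A binary form in terms of its coefficients. -/
lemma binary_form_eq_sum {d : ℕ} {G : MvPolynomial (Fin 2) K} (hG : G.IsHomogeneous d) :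
    G = ∑ j ∈ Finset.range (d + 1),
      C (G.coeff (Finsupp.single 0 (d - j) + Finsupp.single 1 j)) * X 0 ^ (d - j) * X 1 ^ j := by
  have h1 : ∀ (c : K) (a b : ℕ), (C c * X 0 ^ a * X 1 ^ b : MvPolynomial (Fin 2) K) =
      monomial (Finsupp.single 0 a + Finsupp.single 1 b) c := by
    intro c a b
    rw [X_pow_eq_monomial, X_pow_eq_monomial, C_mul_monomial, monomial_mul]
    simp
  simp_rw [h1]
  ext s
  rw [coeff_sum]
  simp_rw [coeff_monomial]
  by_cases hs : s.degree = d
  · have hd : s 0 + s 1 = d := by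
      rw [← hs, Finsupp.degree_eq_sum, Fin.sum_univ_two]
    have hs' : Finsupp.single 0 (d - s 1) + Finsupp.single 1 (s 1) = s := by
      ext i
      fin_cases i <;> (simp; try omega)
    rw [Finset.sum_eq_single (s 1)]
    · rw [hs', if_pos rfl]
    · intro j _ hj
      rw [if_neg]
      intro h
      apply hj
      rw [← h]
      simp
    · intro h
      simp at h
      omega
  · rw [hG.coeff_eq_zero hs]
    symm
    apply Finset.sum_eq_zero
    intro j hj
    rw [if_neg]
    rintro rfl
    apply hs
    rw [Finsupp.degree_eq_sum, Fin.sum_univ_two]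
    simp at hj ⊢
    omega

/-- The coefficient of `S ^ (d - j) * T ^ j` in `F (S x + T y)`, for a form `F` of degree `d`. -/
def lineCoeff {m : ℕ} (F : MvPolynomial (Fin m) K) (d : ℕ) (x y : Fin m → K) (j : ℕ) : K :=
  (aeval (fun i => C (x i) * X 0 + C (y i) * X 1 : Fin m → MvPolynomial (Fin 2) K) F).coeff
    (Finsupp.single 0 (d - j) + Finsupp.single 1 j)

/-- The values `a`, `b` range over any algebra: `K` serves for counting, `K[T]` for comparing
coefficients, and the algebraic closure for containment of a line. -/
lemma aeval_line {m d : ℕ} {F : MvPolynomial (Fin m) K} (hF : F.IsHomogeneous d)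
    {A : Type*} [CommRing A] [Algebra K A] (x y : Fin m → K) (a b : A) :
    aeval (fun i => algebraMap K A (x i) * a + algebraMap K A (y i) * b) F =
      ∑ j ∈ Finset.range (d + 1), algebraMap K A (lineCoeff F d x y j) * a ^ (d - j) * b ^ j := by
  have hG : (aeval (fun i => C (x i) * X 0 + C (y i) * X 1 : Fin m → MvPolynomial (Fin 2) K)
      F).IsHomogeneous (1 * d) :=
    hF.aeval _ fun i => (isHomogeneous_C_mul_X _ _).add (isHomogeneous_C_mul_X _ _)
  rw [one_mul] at hG
  have h := congrArg (aeval ![a, b]) (binary_form_eq_sum hG)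
  simp only [map_sum, map_mul, map_pow, aeval_X, algHom_C] at h
  rw [← AlgHom.comp_apply, comp_aeval] at h
  simpa [lineCoeff] using h

lemma eval_line {m d : ℕ} {F : MvPolynomial (Fin m) K} (hF : F.IsHomogeneous d)
    (x y : Fin m → K) (a b : K) :
    eval (a • x + b • y) F =
      ∑ j ∈ Finset.range (d + 1), lineCoeff F d x y j * a ^ (d - j) * b ^ j := by
  have h := aeval_line hF x y a b
  rw [← coe_aeval_eq_eval]
  simp only [Algebra.algebraMap_self, RingHom.id_apply] at h
  rw [← h]
  have hv : a • x + b • y = fun i => x i * a + y i * b := by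
    ext i
    simp [mul_comm]
  rw [hv]
  rfl

lemma lineCoeff_zero {m d : ℕ} {F : MvPolynomial (Fin m) K} (hF : F.IsHomogeneous d)
    (x y : Fin m → K) : lineCoeff F d x y 0 = eval x F := by
  have h := eval_line hF x y 1 0
  rw [Finset.sum_range_succ', Finset.sum_eq_zero (fun j _ => by simp)] at h
  simpa using h.symm

/-- The polar of `F` at `x`, as a linear functional. -/
def polar {m : ℕ} (F : MvPolynomial (Fin m) K) (x : Fin m → K) : (Fin m → K) →ₗ[K] K :=
  ∑ i, eval x (pderiv i F) • LinearMap.proj i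

lemma polar_apply {m : ℕ} (F : MvPolynomial (Fin m) K) (x y : Fin m → K) :
    polar F x y = ∑ i, eval x (pderiv i F) * y i := by
  simp [polar]

/-- Both sides are the derivative of `F(x + Ty)` at `T = 0`, computed by the chain rule and from the
expansion. -/
lemma lineCoeff_one {m d : ℕ} {F : MvPolynomial (Fin m) K} (hF : F.IsHomogeneous d)
    (hd : 1 ≤ d) (x y : Fin m → K) : lineCoeff F d x y 1 = polar F x y := by
  have h := aeval_line hF x y (1 : Polynomial K) Polynomial.X
  have h1 := congrArg (fun p => Polynomial.eval 0 (Polynomial.derivative p)) h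
  have h2 := derivation_aeval (Polynomial.derivative' : Derivation K (Polynomial K) (Polynomial K))
    (fun i => algebraMap K (Polynomial K) (x i) * 1 +
      algebraMap K (Polynomial K) (y i) * Polynomial.X) F
  rw [Polynomial.derivative'_apply] at h2
  simp only [h2] at h1
  have h3 : ∀ p : MvPolynomial (Fin m) K, Polynomial.eval 0
      (aeval (fun i => algebraMap K (Polynomial K) (x i) * 1 +
        algebraMap K (Polynomial K) (y i) * Polynomial.X) p) = eval x p := by
    intro p
    rw [← Polynomial.coe_aeval_eq_eval, ← coe_aeval_eq_eval]
    simp only [RingHom.coe_coe]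
    rw [← AlgHom.comp_apply, comp_aeval]
    simp
  rw [Polynomial.eval_finsetSum] at h1
  simp only [Polynomial.eval_mul, h3] at h1
  rw [polar_apply]
  have h4 : ∑ i, eval x (pderiv i F) * y i = lineCoeff F d x y 1 := by
    convert! h1 using 1
    · refine Finset.sum_congr rfl fun i _ => ?_
      simp [Polynomial.derivative'_apply]
    · simp only [Polynomial.derivative_sum, Polynomial.eval_finsetSum]
      rw [Finset.sum_eq_single 1]
      · simp
      · intro j _ hj
        rcases j with _ | _ | j
        · simp
        · simp at hj
        · simp
      · intro h
        simp at h
        omega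
  exact h4.symm

lemma polar_self {m d : ℕ} {F : MvPolynomial (Fin m) K} (hF : F.IsHomogeneous d)
    (x : Fin m → K) : polar F x x = d * eval x F := by
  have h := congrArg (eval x) hF.sum_X_mul_pderiv
  simp only [map_sum, map_mul, eval_X, nsmul_eq_mul, map_natCast] at h
  rw [polar_apply, ← h]
  exact Finset.sum_congr rfl fun i _ => mul_comm _ _

/-- A form vanishing identically on the span of two independent vectors contains a line. -/
lemma containsLine_of_lineCoeff {m d : ℕ} {F : MvPolynomial (Fin m) K} (hF : F.IsHomogeneous d)
    {x y : Fin m → K} (hxy : LinearIndependent K ![x, y])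
    (h : ∀ j ∈ Finset.range (d + 1), lineCoeff F d x y j = 0) : ContainsLine F := by
  refine ⟨Submodule.span K (Set.range ![x, y]), ?_, ?_⟩
  · rw [finrank_span_eq_card hxy]
    simp
  · intro z hz
    have hle : Submodule.span (AlgebraicClosure K)
        ((fun (v : Fin m → K) (i : Fin m) => algebraMap K (AlgebraicClosure K) (v i)) ''
          (Submodule.span K (Set.range ![x, y]) : Set (Fin m → K))) ≤
        Submodule.span (AlgebraicClosure K)
          {fun i => algebraMap K (AlgebraicClosure K) (x i),
            fun i => algebraMap K (AlgebraicClosure K) (y i)} := by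
      rw [Submodule.span_le]
      rintro _ ⟨v, hv, rfl⟩
      rw [SetLike.mem_coe, Matrix.range_cons_cons_empty, Submodule.mem_span_pair] at hv
      obtain ⟨a, b, rfl⟩ := hv
      rw [SetLike.mem_coe, Submodule.mem_span_pair]
      refine ⟨algebraMap _ _ a, algebraMap _ _ b, ?_⟩
      ext i
      simp only [Pi.add_apply, Pi.smul_apply, smul_eq_mul, map_add, map_mul]
    obtain ⟨a, b, rfl⟩ := Submodule.mem_span_pair.1 (hle hz)
    have := aeval_line hF x y a b
    rw [Finset.sum_eq_zero (fun j hj => by rw [h j hj]; simp)] at this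
    rw [← this]
    congr 2
    ext i
    simp [mul_comm]

/-! ### The polynomial in one variable attached to a line through a point. -/

section Counting

/-- The univariate polynomial `F (T x + y)`. -/
def linePoly {m : ℕ} (F : MvPolynomial (Fin m) K) (d : ℕ) (x y : Fin m → K) : Polynomial K :=
  ∑ j ∈ Finset.range (d + 1), Polynomial.monomial (d - j) (lineCoeff F d x y j)

lemma eval_linePoly {m d : ℕ} {F : MvPolynomial (Fin m) K} (hF : F.IsHomogeneous d)
    (x y : Fin m → K) (t : K) : (linePoly F d x y).eval t = eval (t • x + y) F := by
  have h := eval_line hF x y t 1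
  rw [one_smul] at h
  simp [h, linePoly, Polynomial.eval_finsetSum, Polynomial.eval_monomial]

lemma coeff_linePoly {m d : ℕ} (F : MvPolynomial (Fin m) K) (x y : Fin m → K) {k : ℕ}
    (hk : k ≤ d) : (linePoly F d x y).coeff k = lineCoeff F d x y (d - k) := by
  simp only [linePoly, Polynomial.finsetSum_coeff, Polynomial.coeff_monomial]
  rw [Finset.sum_eq_single (d - k)]
  · rw [if_pos (by omega)]
  · intro j hj hne
    rw [Finset.mem_range] at hj
    rw [if_neg (by omega)]
  · intro h
    simp at h

lemma natDegree_linePoly_le {m : ℕ} (F : MvPolynomial (Fin m) K) (d : ℕ) (x y : Fin m → K) :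
    (linePoly F d x y).natDegree ≤ d :=
  Polynomial.natDegree_sum_le_of_forall_le _ _ fun _ _ =>
    (Polynomial.natDegree_monomial_le _).trans (Nat.sub_le _ _)

lemma lineCoeff_swap {m d : ℕ} {F : MvPolynomial (Fin m) K} (hF : F.IsHomogeneous d)
    (x y : Fin m → K) {j : ℕ} (hj : j ≤ d) : lineCoeff F d x y j = lineCoeff F d y x (d - j) := by
  have h1 := aeval_line hF x y (1 : Polynomial K) Polynomial.X
  have h2 := aeval_line hF y x (Polynomial.X : Polynomial K) 1
  simp_rw [add_comm (algebraMap K (Polynomial K) (y _) * _)] at h2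
  rw [h1] at h2
  have h3 := congrArg (fun p => Polynomial.coeff p j) h2
  simp only [one_pow, mul_one, Polynomial.algebraMap_eq, Polynomial.finsetSum_coeff,
    Polynomial.coeff_C_mul_X_pow] at h3
  rw [Finset.sum_eq_single j, Finset.sum_eq_single (d - j)] at h3
  · rwa [if_pos rfl, if_pos (by omega)] at h3
  · intro i hi hne
    rw [Finset.mem_range] at hi
    rw [if_neg (by omega)]
  · intro h
    simp at h
  · intro i hi hne
    rw [if_neg (Ne.symm hne)]
  · intro h
    simp at h
    omega

/-- Nonzero as a polynomial: for large `d` it may still vanish at every element of `K`, so the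
absence of lines has to be understood over the algebraic closure. -/
lemma linePoly_ne_zero {m d : ℕ} {F : MvPolynomial (Fin m) K} (hF : F.IsHomogeneous d)
    (hline : ¬ ContainsLine F) {x y : Fin m → K} (hxy : LinearIndependent K ![x, y]) :
    linePoly F d x y ≠ 0 := by
  intro h0
  refine hline (containsLine_of_lineCoeff hF hxy fun j hj => ?_)
  rw [Finset.mem_range] at hj
  have h := coeff_linePoly F x y (Nat.sub_le d j)
  rw [h0, Polynomial.coeff_zero, Nat.sub_sub_self (by omega)] at h
  exact h.symm

/-- In `F(Tx + y)` the point `x` sits at `T = ∞`, so vanishing at `x` shows as a drop in degree;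
tangency at `x` costs one degree more. -/
lemma natDegree_linePoly_le_of_eval {m d : ℕ} {F : MvPolynomial (Fin m) K}
    (hF : F.IsHomogeneous d) {x : Fin m → K} (hx : eval x F = 0) (y : Fin m → K) :
    (linePoly F d x y).natDegree ≤ d - 1 := by
  rw [Polynomial.natDegree_le_iff_coeff_eq_zero]
  intro k hk
  by_cases h : k = d
  · subst h
    rw [coeff_linePoly _ _ _ le_rfl, Nat.sub_self, lineCoeff_zero hF, hx]
  · exact Polynomial.coeff_eq_zero_of_natDegree_lt
      ((natDegree_linePoly_le F d x y).trans_lt (by omega))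

lemma natDegree_linePoly_le_of_polar {m d : ℕ} {F : MvPolynomial (Fin m) K}
    (hF : F.IsHomogeneous d) (hd : 2 ≤ d) {x y : Fin m → K} (hx : eval x F = 0)
    (hxy : polar F x y = 0) : (linePoly F d x y).natDegree ≤ d - 2 := by
  rw [Polynomial.natDegree_le_iff_coeff_eq_zero]
  intro k hk
  by_cases h : k = d - 1
  · rw [h, coeff_linePoly _ _ _ (by omega), show d - (d - 1) = 1 by omega,
      lineCoeff_one hF (by omega), hxy]
  · exact Polynomial.coeff_eq_zero_of_natDegree_lt
      ((natDegree_linePoly_le_of_eval hF hx y).trans_lt (by omega))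

lemma eval_smul_of_isHomogeneous {m d : ℕ} {F : MvPolynomial (Fin m) K} (hF : F.IsHomogeneous d)
    (a : K) (x : Fin m → K) : eval (a • x) F = a ^ d * eval x F := by
  have h := eval_line hF x 0 a 0
  rw [Finset.sum_range_succ', Finset.sum_eq_zero (fun j _ => by simp), lineCoeff_zero hF] at h
  simpa [mul_comm] using h

lemma linearIndependent_of_notMem_span {m : ℕ} {x y : Fin m → K} (hx : x ≠ 0)
    (hy : y ∉ Submodule.span K {x}) : LinearIndependent K ![x, y] := by
  rw [LinearIndependent.pair_iff' hx]
  intro a ha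
  exact hy (Submodule.mem_span_singleton.2 ⟨a, ha⟩)

lemma exists_zero_of_numPoints_ne_zero {m : ℕ} {F : MvPolynomial (Fin m) K}
    (h : numPoints F ≠ 0) : ∃ x : Fin m → K, x ≠ 0 ∧ eval x F = 0 := by
  obtain ⟨P, hP⟩ := Set.nonempty_of_ncard_ne_zero h
  refine ⟨P.rep, P.rep_nonzero, hP _ ?_⟩
  rw [P.submodule_eq]
  exact Submodule.mem_span_singleton_self _

lemma polar_self_eq_zero {n d : ℕ} {F : MvPolynomial (Fin (n + 2)) K}
    (hF : F.IsHomogeneous d) {x : Fin (n + 2) → K} (hx : eval x F = 0) :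
    polar F x x = 0 := by
  rw [polar_self hF, hx, mul_zero]

/-- The kernel of `L` has dimension at least `n + 1 ≥ 2`, too large for the span of `x`. -/
lemma exists_tangent_direction {n : ℕ} (hn : 1 ≤ n) (x : Fin (n + 2) → K)
    (L : (Fin (n + 2) → K) →ₗ[K] K) :
    ∃ y, y ∉ Submodule.span K {x} ∧ L y = 0 := by
  by_contra! h
  have hle : LinearMap.ker L ≤ Submodule.span K {x} := by
    intro y hy
    by_contra hy'
    exact h y hy' hy
  have h1 := Submodule.finrank_mono hle
  have h2 := finrank_span_le_card (R := K) ({x} : Set (Fin (n + 2) → K))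
  have h3 := L.finrank_range_add_finrank_ker
  have h4 := Submodule.finrank_le (LinearMap.range L)
  rw [Module.finrank_self] at h4
  rw [Module.finrank_fin_fun] at h3
  simp at h2
  omega

/-! ### Counting zeros on the lines through a point -/

open scoped Classical in
/-- The number of `t : K` with `F (t x + y) = 0`. -/
def lineZeros [Fintype K] {m : ℕ} (F : MvPolynomial (Fin m) K) (x y : Fin m → K) : ℕ :=
  (Finset.univ.filter fun t : K => eval (t • x + y) F = 0).card

variable [Fintype K]

lemma lineZeros_le_natDegree {m d : ℕ} {F : MvPolynomial (Fin m) K} (hF : F.IsHomogeneous d)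
    {x y : Fin m → K} (h : linePoly F d x y ≠ 0) :
    lineZeros F x y ≤ (linePoly F d x y).natDegree := by
  classical
  refine le_trans ?_ (Polynomial.card_roots' _)
  refine le_trans (Finset.card_le_card ?_) (Multiset.toFinset_card_le _)
  intro t ht
  simp only [Finset.mem_filter, Finset.mem_univ, true_and] at ht
  simp [h, eval_linePoly hF, ht]

/-- A double zero at `T = 0` improves the bound for the number of zeros on a line. -/
lemma lineZeros_add_one_le_natDegree {m d : ℕ} {F : MvPolynomial (Fin m) K}
    (hF : F.IsHomogeneous d) {x y : Fin m → K} (h : linePoly F d x y ≠ 0)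
    (h0 : (linePoly F d x y).coeff 0 = 0) (h1 : (linePoly F d x y).coeff 1 = 0) :
    lineZeros F x y + 1 ≤ (linePoly F d x y).natDegree := by
  classical
  have hdvd : Polynomial.X ^ 2 ∣ linePoly F d x y := by
    rw [Polynomial.X_pow_dvd_iff]
    intro k hk
    interval_cases k
    exacts [h0, h1]
  obtain ⟨r, hr⟩ := hdvd
  have hr0 : r ≠ 0 := by
    rintro rfl
    simp [hr] at h
  have hdeg : (linePoly F d x y).natDegree = 2 + r.natDegree := by
    rw [hr, Polynomial.natDegree_mul (by simp) hr0]
    simp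
  rw [hdeg]
  have hsub : (Finset.univ.filter fun t : K => eval (t • x + y) F = 0) ⊆
      insert 0 r.roots.toFinset := by
    intro t ht
    simp only [Finset.mem_filter, Finset.mem_univ, true_and] at ht
    rw [← eval_linePoly hF, hr] at ht
    simpa [hr0] using ht
  have := (Finset.card_le_card hsub).trans (Finset.card_insert_le _ _)
  have h2 := (Multiset.toFinset_card_le r.roots).trans (Polynomial.card_roots' r)
  unfold lineZeros
  omega

/-- `lineZeros F x y` counts the zeros on the line other than `x`. When `x` and `y` are both zeros,
omitting either one leaves the same number. -/
lemma lineZeros_swap {m d : ℕ} {F : MvPolynomial (Fin m) K} (hF : F.IsHomogeneous d)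
    {x y : Fin m → K} (hx : eval x F = 0) (hy : eval y F = 0) :
    lineZeros F x y = lineZeros F y x := by
  classical
  have key : ∀ {x y : Fin m → K}, eval x F = 0 → ∀ t : K, eval (t • x + y) F = 0 →
      eval (t⁻¹ • y + x) F = 0 := by
    intro x y hx t ht
    by_cases h0 : t = 0
    · simpa [h0] using hx
    · have : t⁻¹ • y + x = t⁻¹ • (t • x + y) := by
        rw [smul_add, smul_smul, inv_mul_cancel₀ h0, one_smul, add_comm]
      rw [this, eval_smul_of_isHomogeneous hF, ht, mul_zero]
  -- As `0⁻¹ = 0`, this bijection matches the zero `y` of the first count (`t = 0`) with the zero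
  -- `x` of the second.
  refine Finset.card_bij (fun t _ => t⁻¹) ?_ ?_ ?_
  · intro t ht
    simp only [Finset.mem_filter, Finset.mem_univ, true_and] at ht ⊢
    exact key hx t ht
  · intro a _ b _ h
    exact inv_injective h
  · intro b hb
    simp only [Finset.mem_filter, Finset.mem_univ, true_and] at hb
    exact ⟨b⁻¹, by simpa using key hy b hb, inv_inv b⟩

open scoped Classical in
/-- The number of zeros of `F` in affine space. -/
def numZeros {m : ℕ} (F : MvPolynomial (Fin m) K) : ℕ :=
  (Finset.univ.filter fun v : Fin m → K => eval v F = 0).card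

/-- For each fixed `t`, translation by `t • x` permutes the vectors `y`. -/
lemma sum_lineZeros {m : ℕ} (F : MvPolynomial (Fin m) K) (x : Fin m → K) :
    ∑ y, lineZeros F x y = Fintype.card K * numZeros F := by
  classical
  simp only [lineZeros, Finset.card_filter]
  rw [Finset.sum_comm]
  have : ∀ t : K, (∑ y : Fin m → K, if eval (t • x + y) F = 0 then 1 else 0) = numZeros F := by
    intro t
    rw [numZeros, Finset.card_filter]
    exact Equiv.sum_comp (Equiv.addLeft (t • x)) fun y => if eval y F = 0 then 1 else 0
  simp [this]

lemma numZeros_eq {m d : ℕ} {F : MvPolynomial (Fin m) K} (hF : F.IsHomogeneous d) (hd : 1 ≤ d) :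
    numZeros F = (Fintype.card K - 1) * numPoints F + 1 := by
  classical
  have h0 : eval (0 : Fin m → K) F = 0 := by
    have := eval_smul_of_isHomogeneous hF 0 (0 : Fin m → K)
    rwa [zero_smul, zero_pow (by omega), zero_mul] at this
  have hmem : ∀ P : ℙ K (Fin m → K), P ∈ rationalPoints F ↔ eval P.rep F = 0 := by
    intro P
    constructor
    · intro h
      refine h _ ?_
      rw [P.submodule_eq]
      exact Submodule.mem_span_singleton_self _
    · intro h v hv
      rw [P.submodule_eq, Submodule.mem_span_singleton] at hv
      obtain ⟨a, rfl⟩ := hv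
      rw [eval_smul_of_isHomogeneous hF, h, mul_zero]
  -- A nonzero zero is a rational point together with a scalar; the zero vector accounts for the `+
  -- 1`.
  let φ : rationalPoints F × Kˣ → {v : Fin m → K // v ≠ 0 ∧ eval v F = 0} := fun p =>
    ⟨p.2 • p.1.1.rep, by
      simpa [Units.smul_def] using p.1.1.rep_nonzero, by
      rw [Units.smul_def, eval_smul_of_isHomogeneous hF, (hmem _).1 p.1.2, mul_zero]⟩
  have hφ : Function.Bijective φ := by
    constructor
    · rintro ⟨⟨P, hP⟩, u⟩ ⟨⟨P', hP'⟩, u'⟩ h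
      have h1 : u • P.rep = u' • P'.rep := congrArg Subtype.val h
      have h2 : P = P' := by
        rw [← P.mk_rep, ← P'.mk_rep, Projectivization.mk_eq_mk_iff]
        refine ⟨u⁻¹ * u', ?_⟩
        rw [mul_smul, ← h1, inv_smul_smul]
      subst h2
      have h3 : u = u' := by
        ext
        exact smul_left_injective K P.rep_nonzero h1
      rw [h3]
    · rintro ⟨v, hv, hFv⟩
      obtain ⟨a, ha⟩ := Projectivization.exists_smul_eq_mk_rep K v hv
      refine ⟨⟨⟨Projectivization.mk K v hv, ?_⟩, a⁻¹⟩, ?_⟩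
      · rw [hmem, ← ha, Units.smul_def, eval_smul_of_isHomogeneous hF, hFv, mul_zero]
      · apply Subtype.ext
        simp only [φ]
        rw [← ha, inv_smul_smul]
  have hcard := Nat.card_congr (Equiv.ofBijective φ hφ)
  rw [Nat.card_prod, Nat.card_coe_set_eq, Nat.card_eq_fintype_card, Fintype.card_units,
    Nat.card_eq_fintype_card, Fintype.card_subtype] at hcard
  rw [numPoints, mul_comm, hcard, numZeros, ← Finset.card_insert_of_notMem (a := 0) (by simp)]
  congr 1
  ext v
  by_cases hv : v = 0
  · simp only [hv, Finset.mem_filter, Finset.mem_univ, true_and, h0, Finset.mem_insert, true_or]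
  · simp [hv]

open scoped Classical in
/-- An upper bound for the number of zeros on the line through `x` in direction `y`. -/
def lineBound {m : ℕ} (F : MvPolynomial (Fin m) K) (d : ℕ) (x y : Fin m → K) : ℕ :=
  if y ∈ Submodule.span K {x} then Fintype.card K else
    if polar F x y = 0 then d - 2 else d - 1

lemma lineZeros_le_lineBound {m d : ℕ} {F : MvPolynomial (Fin m) K} (hF : F.IsHomogeneous d)
    (hd : 2 ≤ d) (hline : ¬ ContainsLine F) {x : Fin m → K} (hx0 : x ≠ 0) (hx : eval x F = 0)
    (y : Fin m → K) : lineZeros F x y ≤ lineBound F d x y := by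
  unfold lineBound
  split_ifs with h1 h2
  · exact Finset.card_le_univ _
  all_goals
    refine (lineZeros_le_natDegree hF
      (linePoly_ne_zero hF hline (linearIndependent_of_notMem_span hx0 h1))).trans ?_
  · exact natDegree_linePoly_le_of_polar hF hd hx h2
  · exact natDegree_linePoly_le_of_eval hF hx y

lemma card_ker_of_ne_zero {m : ℕ} {L : (Fin (m + 1) → K) →ₗ[K] K} (hL : L ≠ 0) :
    Nat.card (LinearMap.ker L) = Fintype.card K ^ m := by
  have h := L.finrank_range_add_finrank_ker
  rw [LinearMap.range_eq_top.2 (LinearMap.surjective hL), finrank_top, Module.finrank_self,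
    Module.finrank_fin_fun] at h
  rw [Module.natCard_eq_pow_finrank (K := K), Nat.card_eq_fintype_card]
  congr 1
  omega

lemma card_span_singleton {m : ℕ} {x : Fin m → K} (hx : x ≠ 0) :
    Nat.card (Submodule.span K {x}) = Fintype.card K := by
  rw [Module.natCard_eq_pow_finrank (K := K), finrank_span_singleton hx, Nat.card_eq_fintype_card,
    pow_one]

/-- The vectors split into the span of `x`, the rest of the tangent hyperplane, and its complement,
of sizes `q`, `q^(n+1) - q` and `q^(n+2) - q^(n+1)`. -/
lemma sum_lineBound {n d : ℕ} {F : MvPolynomial (Fin (n + 2)) K} {x : Fin (n + 2) → K}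
    (hx0 : x ≠ 0) (hxx : polar F x x = 0) (hL : polar F x ≠ 0) :
    ((∑ y, lineBound F d x y : ℕ) : ℤ) = (Fintype.card K : ℤ) ^ 2 +
      ((d - 2 : ℕ) * ((Fintype.card K : ℤ) ^ (n + 1) - Fintype.card K) +
       (d - 1 : ℕ) * ((Fintype.card K : ℤ) ^ (n + 2) - Fintype.card K ^ (n + 1))) := by
  classical
  have hle : Submodule.span K {x} ≤ LinearMap.ker (polar F x) := by
    rw [Submodule.span_le]
    simpa using hxx
  let S : Finset (Fin (n + 2) → K) := Finset.univ.filter fun y => y ∈ Submodule.span K {x}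
  let T : Finset (Fin (n + 2) → K) := Finset.univ.filter fun y => polar F x y = 0
  have hST : S ⊆ T := by
    intro y hy
    simp only [S, T, Finset.mem_filter, Finset.mem_univ, true_and] at hy ⊢
    exact hle hy
  have hS : S.card = Fintype.card K := by
    rw [← card_span_singleton hx0, Nat.card_eq_fintype_card]
    exact (Fintype.card_subtype _).symm
  have hT : T.card = Fintype.card K ^ (n + 1) := by
    rw [← card_ker_of_ne_zero hL, Nat.card_eq_fintype_card]
    exact (Fintype.card_subtype _).symm
  have h1 : ∀ y, lineBound F d x y = (if y ∈ S then Fintype.card K else 0) +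
      ((if y ∈ T \ S then d - 2 else 0) + if y ∈ Tᶜ then d - 1 else 0) := by
    intro y
    have := @hle y
    simp only [lineBound, S, T, Finset.mem_sdiff, Finset.mem_compl, Finset.mem_filter,
      Finset.mem_univ, true_and]
    by_cases h : y ∈ Submodule.span K {x}
    · have h2 : polar F x y = 0 := this h
      simp [h, h2]
    · by_cases h2 : polar F x y = 0 <;> simp [h, h2]
  simp_rw [h1, Finset.sum_add_distrib, Finset.sum_ite_mem, Finset.univ_inter, Finset.sum_const,
    smul_eq_mul]
  rw [Finset.card_sdiff_of_subset hST, Finset.card_compl, Fintype.card_fun, Fintype.card_fin]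
  have h2 := Finset.card_le_card hST
  have h3 : T.card ≤ Fintype.card K ^ (n + 2) := by
    rw [hT]
    exact Nat.pow_le_pow_right Fintype.card_pos (by omega)
  push_cast
  rw [Nat.cast_sub h2, Nat.cast_sub h3, hS, hT]
  push_cast
  ring

lemma sum_lineBound_of_polar_eq_zero {n d : ℕ} {F : MvPolynomial (Fin (n + 2)) K}
    {x : Fin (n + 2) → K} (hx0 : x ≠ 0) (hL : polar F x = 0) :
    ((∑ y, lineBound F d x y : ℕ) : ℤ) = (Fintype.card K : ℤ) ^ 2 +
      (d - 2 : ℕ) * ((Fintype.card K : ℤ) ^ (n + 2) - Fintype.card K) := by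
  classical
  let S : Finset (Fin (n + 2) → K) := Finset.univ.filter fun y => y ∈ Submodule.span K {x}
  have hS : S.card = Fintype.card K := by
    rw [← card_span_singleton hx0, Nat.card_eq_fintype_card]
    exact (Fintype.card_subtype _).symm
  have h1 : ∀ y, lineBound F d x y = (if y ∈ S then Fintype.card K else 0) +
      (if y ∈ Sᶜ then d - 2 else 0) := by
    intro y
    simp only [lineBound, S, Finset.mem_compl, Finset.mem_filter, Finset.mem_univ, true_and, hL]
    by_cases h : y ∈ Submodule.span K {x} <;> simp [h]
  simp_rw [h1, Finset.sum_add_distrib, Finset.sum_ite_mem, Finset.univ_inter, Finset.sum_const,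
    smul_eq_mul]
  rw [Finset.card_compl, Fintype.card_fun, Fintype.card_fin]
  have h3 : S.card ≤ Fintype.card K ^ (n + 2) := by
    rw [hS]
    exact Nat.le_self_pow (by omega) _
  push_cast
  rw [Nat.cast_sub h3, hS]
  push_cast
  ring

/-- The bound for the number of points of a hypersurface without lines. -/
def pointBound (K : Type*) [Field K] [Fintype K] (n d : ℕ) : ℕ :=
  (d - 1) * Fintype.card K ^ n + (d - 2) * Nat.card (ℙ K (Fin n → K)) + 1

/-- This is `q^n = (q - 1) N_q(ℙ^(n-1)) + 1`, multiplied by `(d - 2) q`. It puts the sum of the line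
bounds in the same shape as `card_mul_numZeros`. -/
lemma pointBound_identity {n d : ℕ} :
    (Fintype.card K : ℤ) ^ 2 +
      ((d - 2 : ℕ) * ((Fintype.card K : ℤ) ^ (n + 1) - Fintype.card K) +
       (d - 1 : ℕ) * ((Fintype.card K : ℤ) ^ (n + 2) - Fintype.card K ^ (n + 1))) =
    Fintype.card K * ((Fintype.card K - 1) * pointBound K n d + 1) := by
  have h := Projectivization.card' K (Fin n → K)
  rw [Nat.card_fun, Nat.card_eq_fintype_card (α := K), Nat.card_eq_fintype_card (α := Fin n),
    Fintype.card_fin] at h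
  have h2 : ((Fintype.card K : ℤ)) ^ n =
      Nat.card (ℙ K (Fin n → K)) * ((Fintype.card K : ℤ) - 1) + 1 := by
    have h3 := congrArg (fun k : ℕ => (k : ℤ)) h
    push_cast [Nat.cast_sub (Fintype.card_pos (α := K) : 1 ≤ Fintype.card K)] at h3
    exact h3
  rw [pointBound]
  push_cast
  linear_combination ((d - 2 : ℕ) : ℤ) * (Fintype.card K : ℤ) * h2

lemma card_mul_numZeros {m d : ℕ} {F : MvPolynomial (Fin m) K} (hF : F.IsHomogeneous d)
    (hd : 1 ≤ d) (x : Fin m → K) : ((∑ y, lineZeros F x y : ℕ) : ℤ) =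
      Fintype.card K * ((Fintype.card K - 1) * numPoints F + 1) := by
  rw [sum_lineZeros, numZeros_eq hF hd]
  push_cast [Nat.cast_sub (Fintype.card_pos (α := K) : 1 ≤ Fintype.card K)]
  ring

lemma two_le_card : (2 : ℤ) ≤ Fintype.card K := by
  exact_mod_cast Fintype.one_lt_card (α := K)

/-! ### The bound and the case of equality. -/

section NoLines

variable {n d : ℕ} {F : MvPolynomial (Fin (n + 2)) K}

/-- At a singular point every direction is tangent, so the total falls short of the nonsingular one
by `q^(n+2) - q^(n+1) > 0`. -/
lemma numPoints_lt_pointBound_of_polar_eq_zero (hF : F.IsHomogeneous d) (hd : 2 ≤ d)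
    (hline : ¬ ContainsLine F) {x : Fin (n + 2) → K} (hx0 : x ≠ 0) (hx : eval x F = 0)
    (hL : polar F x = 0) : numPoints F < pointBound K n d := by
  have h1 : ((∑ y, lineZeros F x y : ℕ) : ℤ) ≤ (∑ y, lineBound F d x y : ℕ) := by
    exact_mod_cast Finset.sum_le_sum fun y _ => lineZeros_le_lineBound hF hd hline hx0 hx y
  rw [card_mul_numZeros hF (by omega), sum_lineBound_of_polar_eq_zero hx0 hL] at h1
  have h2 := pointBound_identity (K := K) (n := n) (d := d)
  have hq := two_le_card (K := K)
  have h3 : 0 < (Fintype.card K : ℤ) ^ (n + 2) - Fintype.card K ^ (n + 1) := by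
    rw [pow_succ _ (n + 1)]
    nlinarith [pow_pos (show (0 : ℤ) < Fintype.card K by linarith) (n + 1)]
  have h4 : ((d - 1 : ℕ) : ℤ) = (d - 2 : ℕ) + 1 := by
    exact_mod_cast (by omega : d - 1 = d - 2 + 1)
  rw [h4] at h2
  have h5 : (Fintype.card K : ℤ) * ((Fintype.card K - 1) * numPoints F + 1) <
      Fintype.card K * ((Fintype.card K - 1) * pointBound K n d + 1) := by
    linarith
  have h6 := lt_of_mul_lt_mul_left h5 (by linarith)
  have h7 := lt_of_mul_lt_mul_left (by linarith :
    ((Fintype.card K : ℤ) - 1) * numPoints F < (Fintype.card K - 1) * pointBound K n d)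
    (by linarith)
  exact_mod_cast h7

lemma numPoints_le_pointBound_of_polar_ne_zero (hF : F.IsHomogeneous d) (hd : 2 ≤ d)
    (hline : ¬ ContainsLine F) {x : Fin (n + 2) → K} (hx0 : x ≠ 0) (hx : eval x F = 0)
    (hL : polar F x ≠ 0) : numPoints F ≤ pointBound K n d := by
  have h1 : ((∑ y, lineZeros F x y : ℕ) : ℤ) ≤ (∑ y, lineBound F d x y : ℕ) := by
    exact_mod_cast Finset.sum_le_sum fun y _ => lineZeros_le_lineBound hF hd hline hx0 hx y
  rw [card_mul_numZeros hF (by omega), sum_lineBound hx0 (polar_self_eq_zero hF hx) hL,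
    pointBound_identity] at h1
  have hq := two_le_card (K := K)
  have h6 := le_of_mul_le_mul_left h1 (by linarith)
  have h7 := le_of_mul_le_mul_left (by linarith :
    ((Fintype.card K : ℤ) - 1) * numPoints F ≤ (Fintype.card K - 1) * pointBound K n d)
    (by linarith)
  exact_mod_cast h7

lemma numPoints_eq_pointBound_iff (hF : F.IsHomogeneous d) (hd : 2 ≤ d)
    (hline : ¬ ContainsLine F) {x : Fin (n + 2) → K} (hx0 : x ≠ 0) (hx : eval x F = 0)
    (hL : polar F x ≠ 0) :
    numPoints F = pointBound K n d ↔ ∀ y, lineZeros F x y = lineBound F d x y := by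
  have h1 := Finset.sum_eq_sum_iff_of_le (s := Finset.univ)
    fun y _ => lineZeros_le_lineBound hF hd hline hx0 hx y
  simp only [Finset.mem_univ, true_implies] at h1
  rw [← h1, ← Nat.cast_inj (R := ℤ) (m := ∑ y, lineZeros F x y), card_mul_numZeros hF (by omega),
    sum_lineBound hx0 (polar_self_eq_zero hF hx) hL, pointBound_identity]
  have hq := two_le_card (K := K)
  constructor
  · intro h
    rw [h]
  · intro h
    have h6 := mul_left_cancel₀ (by linarith : (Fintype.card K : ℤ) ≠ 0) h
    have h7 := mul_left_cancel₀ (by linarith : (Fintype.card K : ℤ) - 1 ≠ 0)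
      (add_right_cancel h6)
    exact_mod_cast h7

theorem numPoints_le_pointBound (hF : F.IsHomogeneous d) (hd : 2 ≤ d)
    (hline : ¬ ContainsLine F) : numPoints F ≤ pointBound K n d := by
  by_cases h : numPoints F = 0
  · omega
  obtain ⟨x, hx0, hx⟩ := exists_zero_of_numPoints_ne_zero h
  by_cases hL : polar F x = 0
  · exact (numPoints_lt_pointBound_of_polar_eq_zero hF hd hline hx0 hx hL).le
  · exact numPoints_le_pointBound_of_polar_ne_zero hF hd hline hx0 hx hL

lemma polar_ne_zero_of_eq (hF : F.IsHomogeneous d) (hd : 2 ≤ d) (hline : ¬ ContainsLine F)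
    (heq : numPoints F = pointBound K n d) {x : Fin (n + 2) → K} (hx0 : x ≠ 0)
    (hx : eval x F = 0) : polar F x ≠ 0 := fun hL =>
  (numPoints_lt_pointBound_of_polar_eq_zero hF hd hline hx0 hx hL).ne heq

/-- Equality in the bound forces the degree to be `2`. -/
theorem degree_eq_two_of_eq (hn : 1 ≤ n) (hF : F.IsHomogeneous d) (hd : 2 ≤ d)
    (hline : ¬ ContainsLine F) (heq : numPoints F = pointBound K n d) : d = 2 := by
  by_contra hd2
  obtain ⟨x, hx0, hx⟩ := exists_zero_of_numPoints_ne_zero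
    (show numPoints F ≠ 0 by rw [heq, pointBound]; omega)
  have hall : ∀ {x : Fin (n + 2) → K}, x ≠ 0 → eval x F = 0 →
      ∀ y, lineZeros F x y = lineBound F d x y := fun hx0 hx =>
    (numPoints_eq_pointBound_iff hF hd hline hx0 hx
      (polar_ne_zero_of_eq hF hd hline heq hx0 hx)).1 heq
  obtain ⟨h, hh, hLh⟩ := exists_tangent_direction hn x (polar F x)
  have h1 := hall hx0 hx h
  rw [lineBound, if_neg hh, if_pos hLh] at h1
  -- Since `d - 2 ≥ 1`, the tangent line in direction `h` has a zero besides `x`.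
  obtain ⟨t, ht⟩ := Finset.card_pos.1 (show 0 < lineZeros F x h by omega)
  simp only [Finset.mem_filter, Finset.mem_univ, true_and] at ht
  have hxmem : t • x ∈ Submodule.span K {x} :=
    Submodule.smul_mem _ _ (Submodule.mem_span_singleton_self x)
  generalize hy : t • x + h = y at ht
  have hyx : y ∉ Submodule.span K {x} := by
    intro hmem
    apply hh
    have := Submodule.sub_mem _ hmem hxmem
    rwa [← hy, add_sub_cancel_left] at this
  have hy0 : y ≠ 0 := by
    rintro rfl
    exact hyx (Submodule.zero_mem _)
  have hxy : x ∉ Submodule.span K {y} := by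
    intro hmem
    obtain ⟨a, ha⟩ := Submodule.mem_span_singleton.1 hmem
    have ha0 : a ≠ 0 := by
      rintro rfl
      exact hx0 (by rw [← ha, zero_smul])
    apply hyx
    rw [Submodule.mem_span_singleton]
    exact ⟨a⁻¹, by rw [← ha, smul_smul, inv_mul_cancel₀ ha0, one_smul]⟩
  have hLy : polar F x y = 0 := by
    rw [← hy, map_add, map_smul, hLh, polar_self_eq_zero hF hx]
    simp
  have h2 := hall hx0 hx y
  rw [lineBound, if_neg hyx, if_pos hLy] at h2
  -- Seen from `y`, the line again has `d - 2` further zeros rather than `d - 1`, so it is tangent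
  -- at `y` too.
  have h3 := hall hy0 ht x
  rw [lineZeros_swap hF ht hx, h2, lineBound, if_neg hxy] at h3
  have hLx : polar F y x = 0 := by
    by_contra hne
    rw [if_neg hne] at h3
    omega
  -- Tangency at `x` bounds the degree by `d - 2`, and tangency at `y` is a double zero at `T = 0`;
  -- so there are at most `d - 3` distinct zeros, against the `d - 2` found above.
  have hdeg := natDegree_linePoly_le_of_polar hF hd hx hLy
  have h4 := lineZeros_add_one_le_natDegree hF
    (linePoly_ne_zero hF hline (linearIndependent_of_notMem_span hx0 hyx))
    (by rw [coeff_linePoly _ _ _ (by omega), lineCoeff_swap hF _ _ (by omega), Nat.sub_zero,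
          Nat.sub_self, lineCoeff_zero hF, ht])
    (by rw [coeff_linePoly _ _ _ (by omega), lineCoeff_swap hF _ _ (by omega),
          Nat.sub_sub_self (by omega), lineCoeff_one hF (by omega), hLx])
  omega

/-- A quadric without lines attains the bound as soon as it has a nonsingular rational point. -/
theorem numPoints_eq_of_quadric (hF : F.IsHomogeneous 2) (hline : ¬ ContainsLine F)
    {x : Fin (n + 2) → K} (hx0 : x ≠ 0) (hx : eval x F = 0) (hL : polar F x ≠ 0) :
    numPoints F = pointBound K n 2 := by
  rw [numPoints_eq_pointBound_iff hF le_rfl hline hx0 hx hL]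
  intro y
  refine le_antisymm (lineZeros_le_lineBound hF le_rfl hline hx0 hx y) ?_
  -- Along a line through `x` the form is affine in `t`: a nonzero slope gives a zero, and for slope
  -- zero the required number is `d - 2 = 0`.
  have hval : ∀ t : K, eval (t • x + y) F = polar F x y * t + eval y F := by
    intro t
    have h := eval_line hF x y t 1
    rw [one_smul] at h
    rw [h, Finset.sum_range_succ, Finset.sum_range_succ, Finset.sum_range_one, lineCoeff_zero hF,
      lineCoeff_one hF (by omega), lineCoeff_swap hF x y le_rfl, Nat.sub_self, lineCoeff_zero hF,
      hx]
    ring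
  classical
  unfold lineBound
  split_ifs with h1 h2
  · obtain ⟨a, rfl⟩ := Submodule.mem_span_singleton.1 h1
    rw [lineZeros, Finset.filter_true_of_mem, Finset.card_univ]
    intro t _
    rw [← add_smul, eval_smul_of_isHomogeneous hF, hx, mul_zero]
  · exact Nat.zero_le _
  · refine Finset.card_pos.2 ⟨-eval y F / polar F x y, ?_⟩
    simp only [Finset.mem_filter, Finset.mem_univ, true_and]
    rw [hval]
    field_simp
    ring

end NoLines

end Counting

/-! ### Linear changes of coordinates -/

/-- The form `G ∘ A`, for a linear map `A`. -/
def pullback {m m' : ℕ} (A : (Fin m → K) →ₗ[K] (Fin m' → K)) (G : MvPolynomial (Fin m') K) :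
    MvPolynomial (Fin m) K :=
  bind₁ (fun j => ∑ i, C (A (Pi.single i 1) j) * X i) G

lemma apply_eq_sum {m m' : ℕ} (A : (Fin m → K) →ₗ[K] (Fin m' → K)) (v : Fin m → K) (j : Fin m') :
    A v j = ∑ i, A (Pi.single i 1) j * v i := by
  conv_lhs => rw [← Finset.univ_sum_single v, map_sum, Finset.sum_apply]
  refine Finset.sum_congr rfl fun i _ => ?_
  have : (Pi.single i (v i) : Fin m → K) = v i • Pi.single i 1 := by
    rw [← Pi.single_smul, smul_eq_mul, mul_one]
  rw [this, map_smul, Pi.smul_apply, smul_eq_mul, mul_comm]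

lemma aeval_pullback {m m' : ℕ} (A : (Fin m → K) →ₗ[K] (Fin m' → K))
    (G : MvPolynomial (Fin m') K) {S : Type*} [CommRing S] [Algebra K S] (x : Fin m → S) :
    aeval x (pullback A G) =
      aeval (fun j => ∑ i, algebraMap K S (A (Pi.single i 1) j) * x i) G := by
  rw [pullback, aeval_bind₁]
  simp

lemma eval_pullback {m m' : ℕ} (A : (Fin m → K) →ₗ[K] (Fin m' → K))
    (G : MvPolynomial (Fin m') K) (v : Fin m → K) : eval v (pullback A G) = eval (A v) G := by
  have h := aeval_pullback A G v
  have hv : (fun j => ∑ i, algebraMap K K (A (Pi.single i 1) j) * v i) = A v := by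
    ext j
    rw [apply_eq_sum A v j]
    simp
  rw [hv] at h
  exact h

lemma isHomogeneous_pullback {m m' d : ℕ} (A : (Fin m → K) →ₗ[K] (Fin m' → K))
    {G : MvPolynomial (Fin m') K} (hG : G.IsHomogeneous d) : (pullback A G).IsHomogeneous d := by
  have := hG.aeval (fun j => ∑ i, C (A (Pi.single i 1) j) * X i : Fin m' → MvPolynomial (Fin m) K)
    (n := 1) fun j => IsHomogeneous.sum _ _ _ fun i _ => isHomogeneous_C_mul_X _ _
  rwa [one_mul] at this

lemma pderiv_pullback {m m' : ℕ} (A : (Fin m → K) →ₗ[K] (Fin m' → K))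
    (G : MvPolynomial (Fin m') K) (i : Fin m) :
    pderiv i (pullback A G) = ∑ j, pullback A (pderiv j G) * C (A (Pi.single i 1) j) := by
  have h := derivation_aeval (pderiv i)
    (fun j => ∑ i, C (A (Pi.single i 1) j) * X i : Fin m' → MvPolynomial (Fin m) K) G
  refine h.trans (Finset.sum_congr rfl fun j _ => ?_)
  congr 1
  rw [map_sum, Finset.sum_eq_single i]
  · simp
  · intro k _ hk
    simp [pderiv_X, hk]
  · simp

lemma ProjEquiv.exists_pullback {m m' : ℕ} {F : MvPolynomial (Fin m) K}
    {G : MvPolynomial (Fin m') K} (h : ProjEquiv F G) :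
    ∃ (A : (Fin m → K) ≃ₗ[K] (Fin m' → K)) (c : K), c ≠ 0 ∧ pullback A.toLinearMap G = C c * F :=
  h

lemma ProjEquiv.exists_eval {m m' : ℕ} {F : MvPolynomial (Fin m) K} {G : MvPolynomial (Fin m') K}
    (h : ProjEquiv F G) : ∃ (A : (Fin m → K) ≃ₗ[K] (Fin m' → K)) (c : K), c ≠ 0 ∧
      ∀ v, eval (A v) G = c * eval v F := by
  obtain ⟨A, c, hc, hA⟩ := h.exists_pullback
  refine ⟨A, c, hc, fun v => ?_⟩
  have := congrArg (eval v) hA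
  rw [eval_pullback] at this
  simpa using this

/-- Nonsingularity is invariant under projective equivalence. -/
lemma ProjEquiv.isNonsingular {m m' : ℕ} {F : MvPolynomial (Fin m) K}
    {G : MvPolynomial (Fin m') K} (h : ProjEquiv F G) (hG : IsNonsingular G) :
    IsNonsingular F := by
  obtain ⟨A, c, hc, hA⟩ := h.exists_pullback
  intro x hx0 hx
  have hc' : algebraMap K (AlgebraicClosure K) c ≠ 0 := by simpa using hc
  set y : Fin m' → AlgebraicClosure K :=
    fun j => ∑ i, algebraMap K (AlgebraicClosure K) (A (Pi.single i 1) j) * x i with hy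
  have hAG : ∀ H, aeval x (pullback A.toLinearMap H) = aeval y H := fun H =>
    aeval_pullback A.toLinearMap H x
  have hG0 : aeval y G = 0 := by
    rw [← hAG, hA, map_mul, hx, mul_zero]
  have hy0 : y ≠ 0 := by
    intro h0
    apply hx0
    ext k
    -- The inverse matrix recovers `x` from `y`, also over the algebraic closure.
    have h1 : ∑ j, algebraMap K (AlgebraicClosure K) (A.symm (Pi.single j 1) k) * y j = x k := by
      simp_rw [hy, Finset.mul_sum]
      rw [Finset.sum_comm]
      have h2 : ∀ i, ∑ j, algebraMap K (AlgebraicClosure K) (A.symm (Pi.single j 1) k) *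
          (algebraMap K (AlgebraicClosure K) (A (Pi.single i 1) j) * x i) =
          algebraMap K (AlgebraicClosure K) ((Pi.single i 1 : Fin m → K) k) * x i := by
        intro i
        have h3 := apply_eq_sum A.symm.toLinearMap (A (Pi.single i 1)) k
        simp only [LinearEquiv.coe_coe, LinearEquiv.symm_apply_apply] at h3
        rw [h3, map_sum, Finset.sum_mul]
        exact Finset.sum_congr rfl fun j _ => by rw [map_mul, mul_assoc]
      simp_rw [h2]
      rw [Finset.sum_eq_single k]
      · simp
      · intro i _ hi
        simp [hi.symm]
      · simp
    rw [← h1, h0]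
    simp
  obtain ⟨j, hj⟩ := hG y hy0 hG0
  by_contra! hall
  apply hj
  -- By the chain rule the gradient of `G` at `y` is annihilated by the matrix of `A`, hence is
  -- zero.
  have h1 : ∀ i, ∑ j, aeval y (pderiv j G) *
      algebraMap K (AlgebraicClosure K) (A (Pi.single i 1) j) = 0 := by
    intro i
    have h2 := congrArg (fun p => aeval x (pderiv i p)) hA
    simp only [pderiv_pullback, map_sum, map_mul, pderiv_C_mul, hall i, mul_zero, hAG, algHom_C,
      LinearEquiv.coe_coe] at h2
    exact h2
  have h2 : ∑ i, algebraMap K (AlgebraicClosure K) (A.symm (Pi.single j 1) i) *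
      ∑ k, aeval y (pderiv k G) * algebraMap K (AlgebraicClosure K) (A (Pi.single i 1) k) =
      aeval y (pderiv j G) := by
    simp_rw [Finset.mul_sum]
    rw [Finset.sum_comm]
    have h4 : ∀ k, ∑ i, algebraMap K (AlgebraicClosure K) (A.symm (Pi.single j 1) i) *
        (aeval y (pderiv k G) * algebraMap K (AlgebraicClosure K) (A (Pi.single i 1) k)) =
        aeval y (pderiv k G) *
          algebraMap K (AlgebraicClosure K) ((Pi.single j 1 : Fin m' → K) k) := by
      intro k
      have h3 := apply_eq_sum A.toLinearMap (A.symm (Pi.single j 1)) k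
      simp only [LinearEquiv.coe_coe, LinearEquiv.apply_symm_apply] at h3
      rw [h3, map_sum, Finset.mul_sum]
      exact Finset.sum_congr rfl fun i _ => by rw [map_mul]; ring
    simp_rw [h4]
    rw [Finset.sum_eq_single j]
    · simp
    · intro i _ hi
      simp [hi]
    · simp
  rw [← h2]
  simp [h1]

/-! ### The standard forms -/

lemma isHomogeneous_sumSqConic : (sumSqConic K).IsHomogeneous 2 :=
  ((isHomogeneous_X_pow _ _).add (isHomogeneous_X_pow _ _)).add (isHomogeneous_X_pow _ _)

lemma isHomogeneous_hypConic : (hypConic K).IsHomogeneous 2 :=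
  ((isHomogeneous_X _ _).mul (isHomogeneous_X _ _)).add (isHomogeneous_X_pow _ _)

lemma ellipticForm_eq (α : K) : ellipticForm α =
    C α * X 0 ^ 2 + X 0 * X 1 + X 1 ^ 2 + X 2 * X 3 := by
  simp [ellipticForm, binaryForm]

lemma isHomogeneous_ellipticForm (α : K) : (ellipticForm α).IsHomogeneous 2 := by
  rw [ellipticForm_eq]
  exact (((isHomogeneous_C_mul_X_pow _ _ _).add ((isHomogeneous_X _ _).mul
    (isHomogeneous_X _ _))).add (isHomogeneous_X_pow _ _)).add
    ((isHomogeneous_X _ _).mul (isHomogeneous_X _ _))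

lemma eval_hypConic (v : Fin 3 → K) : eval v (hypConic K) = v 0 * v 1 + v 2 ^ 2 := by
  simp [hypConic]

lemma eval_ellipticForm (α : K) (v : Fin 4 → K) :
    eval v (ellipticForm α) = α * v 0 ^ 2 + v 0 * v 1 + v 1 ^ 2 + v 2 * v 3 := by
  simp [ellipticForm_eq]

lemma isNonsingular_hypConic : IsNonsingular (hypConic K) := by
  intro x hx0 hx
  by_contra! h
  have h0 := h 0
  have h1 := h 1
  simp [hypConic, pderiv_X] at h0 h1 hx
  apply hx0
  ext i
  fin_cases i
  · exact h1
  · exact h0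
  -- The equation of the conic is used here, not the derivative `2 X₂`, which is useless in
  -- characteristic two.
  · simpa [h0, h1] using hx

lemma isNonsingular_ellipticForm {α : K} (hα : 1 - 4 * α ≠ 0) :
    IsNonsingular (ellipticForm α) := by
  intro x hx0 hx
  by_contra! h
  have h0 := h 0
  have h1 := h 1
  have h2 := h 2
  have h3 := h 3
  simp [ellipticForm_eq, pderiv_X] at h0 h1 h2 h3
  have hα' : algebraMap K (AlgebraicClosure K) (1 - 4 * α) ≠ 0 := by
    rwa [Ne, map_eq_zero_iff _ (algebraMap K (AlgebraicClosure K)).injective]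
  have hx1 : x 1 = 0 := by
    have : algebraMap K (AlgebraicClosure K) (1 - 4 * α) * x 1 = 0 := by
      simp only [map_sub, map_mul, map_one, map_ofNat]
      linear_combination h0 - 2 * algebraMap K (AlgebraicClosure K) α * h1
    exact (mul_eq_zero.1 this).resolve_left hα'
  apply hx0
  ext i
  fin_cases i
  · simpa [hx1] using h1
  · exact hx1
  · exact h3
  · exact h2

/-! ### The parameter of an elliptic quadric -/

section Finite

variable [Fintype K]

/-- The sum telescopes to `y^q - y`. -/
lemma sum_pow_two_pow_sub {r : ℕ} (hr : Fintype.card K = 2 ^ r) (y : K) :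
    ∑ i ∈ Finset.range r, ((y ^ 2) ^ 2 ^ i - y ^ 2 ^ i) = 0 := by
  have h := Finset.sum_range_sub (fun i => y ^ 2 ^ i) r
  rw [← hr, FiniteField.pow_card] at h
  simp only [pow_zero, pow_one, sub_self] at h
  rw [← h]
  refine Finset.sum_congr rfl fun i _ => ?_
  rw [← pow_mul, pow_succ' 2 i]

lemma charP_two_of_even (h : Even (Fintype.card K)) : CharP K 2 := by
  have := FiniteField.even_card_iff_char_two.2 (Nat.even_iff.1 h)
  rw [← this]
  infer_instance

lemma two_ne_zero_of_odd (h : Odd (Fintype.card K)) : (2 : K) ≠ 0 :=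
  Ring.two_ne_zero fun h' => by
    have := FiniteField.even_card_iff_char_two.1 h'
    rw [Nat.odd_iff] at h
    omega

/-- In characteristic two, an element of trace zero has the form `y ^ 2 + y`. -/
lemma exists_sq_add_self_of_trace_eq_zero {r : ℕ} (hr : Fintype.card K = 2 ^ r) {α : K}
    (hα : ∑ i ∈ Finset.range r, α ^ 2 ^ i = 0) : ∃ y : K, y ^ 2 + y = α := by
  classical
  have hr0 : r ≠ 0 := by
    rintro rfl
    have := Fintype.one_lt_card (α := K)
    omega
  obtain ⟨s, rfl⟩ := Nat.exists_eq_succ_of_ne_zero hr0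
  have hchar : CharP K 2 := charP_two_of_even (by rw [hr]; exact ⟨2 ^ s, by rw [pow_succ]; ring⟩)
  let T : Polynomial K := ∑ i ∈ Finset.range (s + 1), Polynomial.X ^ 2 ^ i
  have hTeval : ∀ z, T.eval z = ∑ i ∈ Finset.range (s + 1), z ^ 2 ^ i := by
    intro z
    simp [T, Polynomial.eval_finsetSum]
  have hTdeg : T.natDegree ≤ 2 ^ s :=
    Polynomial.natDegree_sum_le_of_forall_le _ _ fun i hi => by
      rw [Polynomial.natDegree_X_pow]
      exact Nat.pow_le_pow_right (by omega) (by simpa [Nat.lt_succ_iff] using hi)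
  have hT0 : T ≠ 0 := by
    intro h0
    have h1 : T.coeff (2 ^ s) = 1 := by
      simp only [T, Polynomial.finsetSum_coeff, Polynomial.coeff_X_pow]
      rw [Finset.sum_eq_single s]
      · simp
      · intro j _ hj
        rw [if_neg fun h => hj (Nat.pow_right_injective le_rfl h).symm]
      · simp
    rw [h0] at h1
    simp at h1
  -- The image of `y ↦ y² + y` consists of roots of the trace polynomial `T`. Its fibres `{y, y +
  -- 1}` give it at least `q / 2 = 2 ^ s` elements, while `T` has at most `2 ^ s` roots; so the two
  -- sets coincide.
  let I : Finset K := Finset.univ.image fun y : K => y ^ 2 + y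
  have hI : I ⊆ T.roots.toFinset := by
    intro z hz
    obtain ⟨y, -, rfl⟩ := Finset.mem_image.1 hz
    rw [Multiset.mem_toFinset, Polynomial.mem_roots hT0, Polynomial.IsRoot, hTeval,
      ← sum_pow_two_pow_sub hr y]
    refine Finset.sum_congr rfl fun i _ => ?_
    have : Fact (Nat.Prime 2) := ⟨Nat.prime_two⟩
    rw [add_pow_char_pow, CharTwo.sub_eq_add]
  have hcard : Fintype.card K ≤ 2 * I.card := by
    refine Finset.card_le_mul_card_image Finset.univ 2 fun b hb => ?_
    obtain ⟨y, -, rfl⟩ := Finset.mem_image.1 hb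
    refine (Finset.card_le_card (t := {y, y + 1}) ?_).trans Finset.card_le_two
    intro z hz
    simp only [Finset.mem_filter, Finset.mem_univ, true_and] at hz
    simp only [Finset.mem_insert, Finset.mem_singleton]
    have h2 : (2 : K) = 0 := CharTwo.two_eq_zero
    have : (z - y) * (z - (y + 1)) = 0 := by
      linear_combination hz - (z * y + z - y ^ 2 - y) * h2
    rcases mul_eq_zero.1 this with h | h
    · exact Or.inl (sub_eq_zero.1 h)
    · exact Or.inr (sub_eq_zero.1 h)
  have heq : I = T.roots.toFinset := by
    refine Finset.eq_of_subset_of_card_le hI ?_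
    have h1 := (Multiset.toFinset_card_le T.roots).trans (Polynomial.card_roots' T)
    rw [hr, Nat.succ_eq_add_one, pow_succ] at hcard
    omega
  have hmem : α ∈ I := by
    rw [heq, Multiset.mem_toFinset, Polynomial.mem_roots hT0, Polynomial.IsRoot, hTeval, hα]
  obtain ⟨y, -, hy⟩ := Finset.mem_image.1 hmem
  exact ⟨y, hy⟩

/-- In characteristic two the trace is `0` or `1`, and it is `0` exactly on the elements `y² + y`.
For odd `q` one completes the square: `(2y + 1)² = 1 - 4α + 4(α + y + y²)`. -/
lemma isEllipticParam_iff (α : K) : IsEllipticParam α ↔ ∀ y : K, α + y + y ^ 2 ≠ 0 := by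
  have hcardne : Fintype.card K ≠ 1 := (Fintype.one_lt_card (α := K)).ne'
  rcases Nat.even_or_odd (Fintype.card K) with heven | hodd
  · have hchar := charP_two_of_even heven
    have hfact : Fact (Nat.Prime 2) := ⟨Nat.prime_two⟩
    obtain ⟨r, -, hr⟩ := FiniteField.card K 2
    constructor
    · intro h y hy
      have h1 := h.1 r hr
      have hα : α = y ^ 2 + y := by
        have h2 : (2 : K) = 0 := CharTwo.two_eq_zero
        linear_combination hy - (y ^ 2 + y) * h2
      have h3 : ∑ i ∈ Finset.range r, α ^ 2 ^ i = 0 := by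
        rw [← sum_pow_two_pow_sub hr y]
        refine Finset.sum_congr rfl fun i _ => ?_
        rw [hα, add_pow_char_pow, CharTwo.sub_eq_add]
      rw [h3] at h1
      exact zero_ne_one h1
    · intro h
      refine ⟨fun r hr => ?_, fun hodd => absurd heven (Nat.not_even_iff_odd.2 hodd)⟩
      -- Frobenius fixes the trace, so the trace is `0` or `1`.
      have h1 : (∑ i ∈ Finset.range r, α ^ 2 ^ i) ^ 2 = ∑ i ∈ Finset.range r, α ^ 2 ^ i := by
        rw [sum_pow_char, ← sub_eq_zero, ← Finset.sum_sub_distrib, ← sum_pow_two_pow_sub hr α]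
        refine Finset.sum_congr rfl fun i _ => ?_
        rw [← pow_mul, ← pow_mul, mul_comm]
      have h2 : ∑ i ∈ Finset.range r, α ^ 2 ^ i ≠ 0 := by
        intro h0
        obtain ⟨y, hy⟩ := exists_sq_add_self_of_trace_eq_zero hr h0
        apply h y
        have h2 : (2 : K) = 0 := CharTwo.two_eq_zero
        rw [← hy]
        linear_combination (y ^ 2 + y) * h2
      rw [sq] at h1
      exact mul_right_cancel₀ h2 (by rw [h1, one_mul])
  · have h2 := two_ne_zero_of_odd hodd
    constructor
    · intro h y hy
      exact h.2 hodd ⟨2 * y + 1, by linear_combination -4 * hy⟩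
    · intro h
      refine ⟨fun r hr => ?_, fun _ => ?_⟩
      · exfalso
        rcases r with _ | r
        · exact hcardne hr
        · rw [hr, pow_succ] at hodd
          exact Nat.not_even_iff_odd.2 hodd ⟨2 ^ r, by ring⟩
      · rintro ⟨s, hs⟩
        apply h ((s - 1) / 2)
        field_simp
        linear_combination -hs

lemma one_sub_four_mul_ne_zero {α : K} (hα : IsEllipticParam α) : 1 - 4 * α ≠ 0 := by
  rcases Nat.even_or_odd (Fintype.card K) with heven | hodd
  · have := charP_two_of_even heven
    have h2 : (2 : K) = 0 := CharTwo.two_eq_zero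
    have : 1 - 4 * α = 1 := by linear_combination -2 * α * h2
    rw [this]
    exact one_ne_zero
  · intro h
    exact hα.2 hodd (by rw [h]; exact IsSquare.zero)

/-- The binary form of an elliptic quadric is irreducible. -/
theorem irreducible_binaryForm {α : K} (hα : IsEllipticParam α) : Irreducible (binaryForm α) := by
  have hroot := (isEllipticParam_iff α).1 hα
  have hα0 : α ≠ 0 := fun h => hroot 0 (by simp [h])
  -- View the form as a quadratic in `X₀` over `K[X₁]`, made monic by the unit `α⁻¹`; a
  -- factorization is then a pair of coefficients with known sum and product.
  rw [← MulEquiv.irreducible_iff (finSuccEquiv K 1)]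
  have hu : IsUnit (Polynomial.C (C α⁻¹ : MvPolynomial (Fin 1) K)) :=
    ((IsUnit.mk0 _ (inv_ne_zero hα0)).map C).map Polynomial.C
  rw [← irreducible_isUnit_mul hu]
  have hp : Polynomial.C (C α⁻¹ : MvPolynomial (Fin 1) K) * finSuccEquiv K 1 (binaryForm α) =
      Polynomial.X ^ 2 + Polynomial.C (C α⁻¹ * X 0) * Polynomial.X +
        Polynomial.C (C α⁻¹ * X 0 ^ 2) := by
    have hX1 : finSuccEquiv K 1 (X 1) = Polynomial.C (X 0) := finSuccEquiv_X_succ (j := 0)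
    have hC : Polynomial.C (C α⁻¹ : MvPolynomial (Fin 1) K) * Polynomial.C (C α) = 1 := by
      rw [← Polynomial.C_mul, ← C_mul, inv_mul_cancel₀ hα0]
      simp
    have hCα : finSuccEquiv K 1 (C α) = Polynomial.C (C α) := by
      simp [finSuccEquiv_apply]
    simp only [binaryForm, map_add, map_mul, map_pow, finSuccEquiv_X_zero, hX1, hCα]
    linear_combination Polynomial.X ^ 2 * hC
  rw [hp]
  have hdeg : (Polynomial.X ^ 2 + Polynomial.C (C α⁻¹ * X 0) * Polynomial.X +
      Polynomial.C (C α⁻¹ * X 0 ^ 2) : Polynomial (MvPolynomial (Fin 1) K)).natDegree = 2 := by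
    compute_degree!
  have hmonic : (Polynomial.X ^ 2 + Polynomial.C (C α⁻¹ * X 0) * Polynomial.X +
      Polynomial.C (C α⁻¹ * X 0 ^ 2) : Polynomial (MvPolynomial (Fin 1) K)).Monic := by
    monicity!
  by_contra hirr
  obtain ⟨c₁, c₂, h0, h1⟩ :=
    (hmonic.not_irreducible_iff_exists_add_mul_eq_coeff hdeg).1 hirr
  rw [Polynomial.coeff_add, Polynomial.coeff_add, Polynomial.coeff_C_mul, Polynomial.coeff_X_pow,
    Polynomial.coeff_X, Polynomial.coeff_C] at h0 h1
  norm_num at h0 h1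
  -- Setting `X₁ = 1` gives `α⁻¹ f(X₀, 1) = (X₀ + a)(X₀ + b)`. The zero `(-a, 1)`, rescaled to `(1,
  -- -a⁻¹)`, is the forbidden root.
  have e0 := congrArg (eval fun _ => (1 : K)) h0
  have e1 := congrArg (eval fun _ => (1 : K)) h1
  simp only [map_mul, map_pow, map_add, eval_C, eval_X, one_pow, mul_one] at e0 e1
  generalize eval (fun _ => (1 : K)) c₁ = a at e0 e1
  generalize eval (fun _ => (1 : K)) c₂ = b at e0 e1
  have ha : a ≠ 0 := by
    rintro rfl
    rw [zero_mul] at e0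
    exact inv_ne_zero hα0 e0
  have hab : α * (a * b) = 1 := by rw [← e0, mul_inv_cancel₀ hα0]
  have hab' : α * (a + b) = 1 := by rw [← e1, mul_inv_cancel₀ hα0]
  apply hroot (-a⁻¹)
  field_simp
  linear_combination a * hab' - hab

end Finite

/-! ### Quadrics -/

section Quadric

variable {m : ℕ} {F : MvPolynomial (Fin m) K}

lemma eval_smul_add_smul (hF : F.IsHomogeneous 2) (a b : K) (x y : Fin m → K) :
    eval (a • x + b • y) F = a ^ 2 * eval x F + a * b * polar F x y + b ^ 2 * eval y F := by
  rw [eval_line hF, Finset.sum_range_succ, Finset.sum_range_succ, Finset.sum_range_one,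
    lineCoeff_zero hF, lineCoeff_one hF (by omega), lineCoeff_swap hF x y le_rfl, Nat.sub_self,
    lineCoeff_zero hF]
  ring

lemma eval_add_eq (hF : F.IsHomogeneous 2) (x y : Fin m → K) :
    eval (x + y) F = eval x F + polar F x y + eval y F := by
  simpa using eval_smul_add_smul hF 1 1 x y

lemma polar_comm (hF : F.IsHomogeneous 2) (x y : Fin m → K) : polar F x y = polar F y x := by
  have h1 := eval_add_eq hF x y
  have h2 := eval_add_eq hF y x
  rw [add_comm y x] at h2
  linear_combination h2 - h1

lemma polar_smul_left (hF : F.IsHomogeneous 2) (a : K) (x y : Fin m → K) :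
    polar F (a • x) y = a * polar F x y := by
  rw [polar_comm hF, map_smul, polar_comm hF, smul_eq_mul]

lemma polar_add_left (hF : F.IsHomogeneous 2) (x x' y : Fin m → K) :
    polar F (x + x') y = polar F x y + polar F x' y := by
  rw [polar_comm hF, map_add, polar_comm hF y x, polar_comm hF y x']

lemma containsLine_of_quadric (hF : F.IsHomogeneous 2) {x y : Fin m → K}
    (hxy : LinearIndependent K ![x, y]) (hx : eval x F = 0) (hy : eval y F = 0)
    (hp : polar F x y = 0) : ContainsLine F := by
  refine containsLine_of_lineCoeff hF hxy fun j hj => ?_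
  rw [Finset.mem_range] at hj
  interval_cases j
  · rw [lineCoeff_zero hF, hx]
  · rw [lineCoeff_one hF (by omega), hp]
  · rw [lineCoeff_swap hF x y le_rfl, Nat.sub_self, lineCoeff_zero hF, hy]

lemma exists_hyperbolic_pair (hF : F.IsHomogeneous 2) {e : Fin m → K} (he : eval e F = 0)
    (hL : polar F e ≠ 0) : ∃ f, eval f F = 0 ∧ polar F e f = 1 := by
  obtain ⟨g, hg⟩ := LinearMap.surjective hL 1
  have hee : polar F e e = 0 := by rw [polar_self hF, he, mul_zero]
  -- Moving `g` along the isotropic vector `e` changes `F` linearly with slope `1`, so this multiple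
  -- cancels `F(g)`.
  refine ⟨(-eval g F) • e + g, ?_, ?_⟩
  · rw [← one_smul K g, eval_smul_add_smul hF, one_smul, he, hg]
    ring
  · rw [map_add, map_smul, hee, hg, smul_zero, zero_add]

/-- The orthogonal complement of two vectors contains independent vectors. -/
lemma exists_linearIndependent_orthogonal {n k : ℕ} (hk : k ≤ n)
    (F : MvPolynomial (Fin (n + 2)) K) (e f : Fin (n + 2) → K) :
    ∃ u : Fin k → Fin (n + 2) → K, LinearIndependent K u ∧
      ∀ i, polar F e (u i) = 0 ∧ polar F f (u i) = 0 := by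
  let L : (Fin (n + 2) → K) →ₗ[K] K × K := (polar F e).prod (polar F f)
  have h1 := L.finrank_range_add_finrank_ker
  have h2 := Submodule.finrank_le (LinearMap.range L)
  rw [Module.finrank_prod, Module.finrank_self] at h2
  rw [Module.finrank_fin_fun] at h1
  obtain ⟨u, hu⟩ := exists_linearIndependent_of_le_finrank (R := K) (M := LinearMap.ker L)
    (n := k) (by omega)
  refine ⟨fun i => (u i : Fin (n + 2) → K),
    hu.map' (LinearMap.ker L).subtype (Submodule.ker_subtype _), fun i => ?_⟩
  have := (u i).2
  rw [LinearMap.mem_ker] at this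
  exact Prod.ext_iff.1 this

/-- A quadric without lines is anisotropic on the orthogonal complement of a hyperbolic pair. -/
lemma eval_ne_zero_of_orthogonal (hF : F.IsHomogeneous 2) (hline : ¬ ContainsLine F)
    {e f u : Fin m → K} (he : eval e F = 0) (hef : polar F e f = 1) (heu : polar F e u = 0)
    (hfu : polar F f u = 0) (hu : u ≠ 0) : eval u F ≠ 0 := by
  intro hFu
  have he0 : e ≠ 0 := by
    rintro rfl
    rw [polar_comm hF, map_zero] at hef
    exact zero_ne_one hef
  refine hline (containsLine_of_quadric hF (linearIndependent_of_notMem_span he0 ?_) he hFu heu)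
  -- A multiple of `e` orthogonal to `f` is zero.
  intro hmem
  obtain ⟨a, rfl⟩ := Submodule.mem_span_singleton.1 hmem
  rw [map_smul, polar_comm hF, hef, smul_eq_mul, mul_one] at hfu
  exact hu (by rw [hfu, zero_smul])

/-- Vectors orthogonal to a hyperbolic pair are independent of it. -/
lemma eq_zero_of_hyperbolic_add_eq_zero (hF : F.IsHomogeneous 2) {e f u : Fin m → K}
    (he : eval e F = 0) (hf : eval f F = 0) (hef : polar F e f ≠ 0) (heu : polar F e u = 0)
    (hfu : polar F f u = 0) {a b : K} (h : a • e + b • f + u = 0) : a = 0 ∧ b = 0 ∧ u = 0 := by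
  have hee : polar F e e = 0 := by rw [polar_self hF, he, mul_zero]
  have hff : polar F f f = 0 := by rw [polar_self hF, hf, mul_zero]
  have h1 := congrArg (polar F e) h
  have h2 := congrArg (polar F f) h
  simp only [map_add, map_smul, hee, heu, hff, hfu, map_zero, smul_eq_mul, mul_zero, add_zero,
    zero_add, polar_comm hF f e] at h1 h2
  have hb : b = 0 := (mul_eq_zero.1 h1).resolve_right hef
  have ha : a = 0 := (mul_eq_zero.1 h2).resolve_right hef
  refine ⟨ha, hb, ?_⟩
  simpa [ha, hb] using h

lemma eval_hyperbolic_add (hF : F.IsHomogeneous 2) {e f u : Fin m → K}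
    (he : eval e F = 0) (hf : eval f F = 0) (heu : polar F e u = 0)
    (hfu : polar F f u = 0) (a b : K) :
    eval (a • e + b • f + u) F = a * b * polar F e f + eval u F := by
  rw [eval_add_eq hF, eval_smul_add_smul hF, polar_add_left hF, polar_smul_left hF,
    polar_smul_left hF, he, hf, heu, hfu]
  ring

end Quadric

/-- Equivalence with a quadric having a hyperbolic pair yields a nonsingular rational point. -/
lemma ProjEquiv.exists_nonsingular_point {m m' : ℕ} {F : MvPolynomial (Fin m) K}
    {G : MvPolynomial (Fin m') K} (h : ProjEquiv F G) (hF : F.IsHomogeneous 2)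
    {y z : Fin m' → K} (hy : eval y G = 0) (hz : eval z G = 0) (hyz : eval (y + z) G ≠ 0) :
    ∃ x : Fin m → K, x ≠ 0 ∧ eval x F = 0 ∧ polar F x ≠ 0 := by
  obtain ⟨A, c, hc, hA⟩ := h.exists_eval
  have h1 : ∀ v, eval (A.symm v) F = c⁻¹ * eval v G := by
    intro v
    have := hA (A.symm v)
    rw [A.apply_symm_apply] at this
    rw [this, inv_mul_cancel_left₀ hc]
  refine ⟨A.symm y, ?_, by rw [h1, hy, mul_zero], ?_⟩
  · intro h0
    have hy0 : y = 0 := by simpa using h0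
    rw [hy0, zero_add] at hyz
    exact hyz hz
  · intro hL
    have h2 := eval_add_eq hF (A.symm y) (A.symm z)
    rw [← map_add, h1, h1, h1, hy, hz, hL, LinearMap.zero_apply, mul_zero, add_zero,
      add_zero] at h2
    exact hyz ((mul_eq_zero.1 h2).resolve_left (inv_ne_zero hc))

/-! ### Classification of quadrics without lines over a finite field. -/

section Finite

variable [Fintype K]

/-- Forms in more variables than their degree have nontrivial zeros. -/
lemma exists_ne_zero_eval_eq_zero {m d : ℕ} {G : MvPolynomial (Fin m) K} (hG : G.IsHomogeneous d)
    (hd : 1 ≤ d) (hm : d < m) : ∃ x : Fin m → K, x ≠ 0 ∧ eval x G = 0 := by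
  classical
  obtain ⟨p, hp⟩ := CharP.exists K
  have hprime : p.Prime := CharP.char_is_prime K p
  -- Chevalley–Warning: the characteristic divides the number of zeros, so the trivial zero is not
  -- the only one.
  have h := char_dvd_card_solutions (K := K) p (f := G)
    (by rw [Fintype.card_fin]; exact hG.totalDegree_le.trans_lt hm)
  have h0 : eval (0 : Fin m → K) G = 0 := by
    have := eval_smul_of_isHomogeneous hG 0 (0 : Fin m → K)
    rwa [zero_smul, zero_pow (by omega), zero_mul] at this
  have hpos : 0 < Fintype.card {x : Fin m → K // eval x G = 0} :=
    Fintype.card_pos_iff.2 ⟨⟨0, h0⟩⟩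
  have h1 : 1 < Fintype.card {x : Fin m → K // eval x G = 0} :=
    hprime.one_lt.trans_le (Nat.le_of_dvd hpos h)
  obtain ⟨x, hx⟩ := Fintype.exists_ne_of_one_lt_card h1 ⟨0, h0⟩
  exact ⟨x.1, fun h => hx (Subtype.ext h), x.2⟩

/-- Quadratic forms with equal values are equal as polynomials even over the field of two elements,
because they are homogeneous of degree `2 ≤ q`. -/
lemma projEquiv_of_eval {m m' : ℕ} {F : MvPolynomial (Fin m) K} {G : MvPolynomial (Fin m') K}
    (hF : F.IsHomogeneous 2) (hG : G.IsHomogeneous 2) (A : (Fin m → K) ≃ₗ[K] (Fin m' → K)) {c : K}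
    (hc : c ≠ 0) (h : ∀ v, eval (A v) G = c * eval v F) : ProjEquiv F G := by
  have hA : pullback A.toLinearMap G = C c * F := by
    refine IsHomogeneous.funext_of_le_card (n := 2) (isHomogeneous_pullback _ hG) (hF.C_mul _)
      (fun v => ?_) ?_
    · rw [eval_pullback, map_mul, eval_C, ← h, LinearEquiv.coe_coe]
    · rw [Cardinal.mk_fintype]
      exact_mod_cast Fintype.one_lt_card (α := K)
  exact ⟨A, c, hc, hA⟩

lemma ProjEquiv.symm_of_quadric {m m' : ℕ} {F : MvPolynomial (Fin m) K}
    {G : MvPolynomial (Fin m') K} (hF : F.IsHomogeneous 2) (hG : G.IsHomogeneous 2)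
    (h : ProjEquiv F G) : ProjEquiv G F := by
  obtain ⟨A, c, hc, hA⟩ := h.exists_eval
  refine projEquiv_of_eval hG hF A.symm (inv_ne_zero hc) fun v => ?_
  have := hA (A.symm v)
  rw [A.apply_symm_apply] at this
  rw [this, inv_mul_cancel_left₀ hc]

lemma ProjEquiv.trans_of_quadric {m m' m'' : ℕ} {F : MvPolynomial (Fin m) K}
    {G : MvPolynomial (Fin m') K} {H : MvPolynomial (Fin m'') K} (hF : F.IsHomogeneous 2)
    (hH : H.IsHomogeneous 2) (h1 : ProjEquiv F G) (h2 : ProjEquiv G H) : ProjEquiv F H := by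
  obtain ⟨A, c, hc, hA⟩ := h1.exists_eval
  obtain ⟨B, c', hc', hB⟩ := h2.exists_eval
  refine projEquiv_of_eval hF hH (A.trans B) (mul_ne_zero hc' hc) fun v => ?_
  rw [LinearEquiv.trans_apply, hB, hA, mul_assoc]

lemma projEquiv_of_linearIndependent {m m' : ℕ} [NeZero m'] (hm : m = m')
    {F : MvPolynomial (Fin m) K} {G : MvPolynomial (Fin m') K} (hF : F.IsHomogeneous 2)
    (hG : G.IsHomogeneous 2) {v : Fin m' → Fin m → K} (hv : LinearIndependent K v) {c : K}
    (hc : c ≠ 0) (h : ∀ x : Fin m' → K, eval (∑ i, x i • v i) F = c * eval x G) :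
    ProjEquiv F G := by
  let b := basisOfLinearIndependentOfCardEqFinrank hv (by simp [hm])
  refine projEquiv_of_eval hF hG b.equivFun (inv_ne_zero hc) fun y => ?_
  have h1 := h (b.equivFun y)
  have h2 : ∑ i, b.equivFun y i • v i = y := by
    conv_rhs => rw [← b.equivFun.symm_apply_apply y, b.equivFun_symm_apply]
    simp [b]
  rw [h2] at h1
  rw [h1, inv_mul_cancel_left₀ hc]

/-- A conic with a rational point, all of whose rational points are nonsingular, is equivalent to
`X₀X₁ + X₂²`. -/
theorem projEquiv_hypConic {n : ℕ} (hn : n = 1) {F : MvPolynomial (Fin (n + 2)) K}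
    (hF : F.IsHomogeneous 2) (hns : ∀ x : Fin (n + 2) → K, x ≠ 0 → eval x F = 0 → polar F x ≠ 0)
    {e : Fin (n + 2) → K} (he0 : e ≠ 0) (he : eval e F = 0) : ProjEquiv F (hypConic K) := by
  obtain ⟨f, hf, hef⟩ := exists_hyperbolic_pair hF he (hns e he0 he)
  obtain ⟨v, hv, hvo⟩ := exists_linearIndependent_orthogonal (k := 1) (by omega) F e f
  obtain ⟨heu, hfu⟩ := hvo 0
  have hu0 := hv.ne_zero 0
  generalize v 0 = u at heu hfu hu0
  -- The scalar `s` will be `F(u)`, which makes `F` equal `F(u)(X₀X₁ + X₂²)` in this basis; `s = 1`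
  -- is used before `F(u) ≠ 0` is known.
  have hli : ∀ s : K, s ≠ 0 → LinearIndependent K ![s • e, f, u] := by
    intro s hs
    rw [Fintype.linearIndependent_iff]
    intro g hg
    simp only [Fin.sum_univ_three, Matrix.cons_val_zero, Matrix.cons_val_one, Matrix.cons_val] at hg
    rw [smul_smul] at hg
    obtain ⟨h0, h1, h2⟩ := eq_zero_of_hyperbolic_add_eq_zero hF he hf (by rw [hef]; simp)
      (by rw [map_smul, heu, smul_zero]) (by rw [map_smul, hfu, smul_zero]) hg
    intro i
    fin_cases i
    · exact (mul_eq_zero.1 h0).resolve_right hs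
    · exact h1
    · exact (smul_eq_zero.1 h2).resolve_right hu0
  -- Otherwise `u` is orthogonal to `e`, `f` and itself, hence a singular point.
  have hFu : eval u F ≠ 0 := by
    intro hFu
    apply hns u hu0 hFu
    let b := basisOfLinearIndependentOfCardEqFinrank (hli 1 one_ne_zero) (by simp [hn])
    refine b.ext fun i => ?_
    fin_cases i
    · simp [b, polar_comm hF u, heu]
    · simp [b, polar_comm hF u, hfu]
    · simp [b, polar_self hF, hFu]
  refine projEquiv_of_linearIndependent (by omega) hF isHomogeneous_hypConic (hli _ hFu) hFu
    fun x => ?_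
  simp only [Fin.sum_univ_three, Matrix.cons_val_zero, Matrix.cons_val_one, Matrix.cons_val]
  rw [smul_smul, eval_hyperbolic_add hF he hf (by rw [map_smul, heu, smul_zero])
    (by rw [map_smul, hfu, smul_zero]), eval_smul_of_isHomogeneous hF, hef, eval_hypConic]
  ring

/-- A binary anisotropic form can be normalized. -/
lemma exists_normalized_pair {m : ℕ} {F : MvPolynomial (Fin m) K} (hF : F.IsHomogeneous 2)
    {u w : Fin m → K} (h : ∀ a b : K, (a ≠ 0 ∨ b ≠ 0) → eval (a • u + b • w) F ≠ 0) :
    ∃ s t : K, s ≠ 0 ∧ polar F (s • u + t • w) w = eval w F := by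
  have hw : eval w F ≠ 0 := by simpa using h 0 1 (Or.inr one_ne_zero)
  have hww : polar F w w = 2 * eval w F := by simpa using polar_self hF w
  by_cases hb : polar F u w = 0
  -- In characteristic two, `F(au + bw) = a²F(u) + b²F(w)` would have a nontrivial zero, since every
  -- element is a square.
  · have h2 : (2 : K) ≠ 0 := by
      intro h2
      have hchar : ringChar K = 2 := by
        have h3 : ringChar K ∣ 2 := (ringChar.spec K 2).1 (by exact_mod_cast h2)
        exact (Nat.prime_dvd_prime_iff_eq (CharP.char_is_prime K _) Nat.prime_two).1 h3
      obtain ⟨r, hr⟩ := FiniteField.isSquare_of_char_two hchar (eval u F / eval w F)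
      rw [div_eq_iff hw] at hr
      apply h 1 r (Or.inl one_ne_zero)
      rw [eval_smul_add_smul hF, hb, hr]
      linear_combination r * r * eval w F * h2
    -- As `polar F w w = 2F(w)`, adding `w / 2` to `u` supplies the missing mixed term.
    refine ⟨1, 2⁻¹, one_ne_zero, ?_⟩
    rw [polar_add_left hF, polar_smul_left hF, polar_smul_left hF, hb, hww,
      inv_mul_cancel_left₀ h2]
    ring
  · refine ⟨eval w F / polar F u w, 0, div_ne_zero hw hb, ?_⟩
    rw [polar_add_left hF, polar_smul_left hF, polar_smul_left hF, div_mul_cancel₀ _ hb]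
    ring

/-- A quadric surface without lines that has a nonsingular rational point is an elliptic quadric. -/
theorem exists_projEquiv_ellipticForm {n : ℕ} (hn : n = 2) {F : MvPolynomial (Fin (n + 2)) K}
    (hF : F.IsHomogeneous 2) (hline : ¬ ContainsLine F) {e : Fin (n + 2) → K}
    (he : eval e F = 0) (hL : polar F e ≠ 0) :
    ∃ α : K, IsEllipticParam α ∧ ProjEquiv F (ellipticForm α) := by
  obtain ⟨f, hf, hef⟩ := exists_hyperbolic_pair hF he hL
  obtain ⟨v, hv, hvo⟩ := exists_linearIndependent_orthogonal (k := 2) (by omega) F e f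
  obtain ⟨heu, hfu⟩ := hvo 0
  obtain ⟨hew, hfw⟩ := hvo 1
  have hvli : ∀ a b : K, a • v 0 + b • v 1 = 0 → a = 0 ∧ b = 0 := by
    intro a b hab
    have h1 := Fintype.linearIndependent_iff.1 hv ![a, b] (by simpa using hab)
    exact ⟨h1 0, h1 1⟩
  generalize v 0 = u at heu hfu hvli
  generalize v 1 = w at hew hfw hvli
  have hean : ∀ a b : K, polar F e (a • u + b • w) = 0 := fun a b => by
    rw [map_add, map_smul, map_smul, heu, hew, smul_zero, smul_zero, add_zero]
  have hfan : ∀ a b : K, polar F f (a • u + b • w) = 0 := fun a b => by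
    rw [map_add, map_smul, map_smul, hfu, hfw, smul_zero, smul_zero, add_zero]
  have han : ∀ a b : K, (a ≠ 0 ∨ b ≠ 0) → eval (a • u + b • w) F ≠ 0 := by
    intro a b hab
    refine eval_ne_zero_of_orthogonal hF hline he hef (hean a b) (hfan a b) fun h0 => ?_
    have := hvli a b h0
    tauto
  obtain ⟨s, t, hs, hst⟩ := exists_normalized_pair hF han
  have hw : eval w F ≠ 0 := by simpa using han 0 1 (Or.inr one_ne_zero)
  have hcomb : ∀ a b : K, a • (s • u + t • w) + b • w = (a * s) • u + (a * t + b) • w := by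
    intro a b
    module
  have hval : ∀ a b : K, eval (a • (s • u + t • w) + b • w) F =
      eval w F * (eval (s • u + t • w) F / eval w F * a ^ 2 + a * b + b ^ 2) := by
    intro a b
    rw [eval_smul_add_smul hF, hst]
    field_simp
  refine ⟨eval (s • u + t • w) F / eval w F, ?_, ?_⟩
  · rw [isEllipticParam_iff]
    intro y hy
    have h1 := hval 1 y
    rw [hcomb] at h1
    refine han _ _ (Or.inl (by simpa using hs)) (h1.trans ?_)
    linear_combination eval w F * hy
  -- Scaling `e` by `F(w)` lets the common factor `F(w)` be taken out of both the binary part and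
  -- the hyperbolic part.
  · have hli : LinearIndependent K ![s • u + t • w, w, eval w F • e, f] := by
      rw [Fintype.linearIndependent_iff]
      intro g hg
      simp only [Fin.sum_univ_four, Matrix.cons_val_zero, Matrix.cons_val_one,
        Matrix.cons_val] at hg
      have hg' : (g 2 * eval w F) • e + g 3 • f +
          ((g 0 * s) • u + (g 0 * t + g 1) • w) = 0 := by
        rw [← hcomb, ← hg]
        module
      obtain ⟨h2, h3, h01⟩ := eq_zero_of_hyperbolic_add_eq_zero hF he hf (by rw [hef]; simp)
        (hean _ _) (hfan _ _) hg'
      obtain ⟨h0, h1⟩ := hvli _ _ h01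
      have h0' : g 0 = 0 := (mul_eq_zero.1 h0).resolve_right hs
      intro i
      fin_cases i
      · exact h0'
      · simpa [h0'] using h1
      · exact (mul_eq_zero.1 h2).resolve_right hw
      · exact h3
    refine projEquiv_of_linearIndependent (by omega) hF (isHomogeneous_ellipticForm _) hli hw
      fun x => ?_
    simp only [Fin.sum_univ_four, Matrix.cons_val_zero, Matrix.cons_val_one, Matrix.cons_val]
    have hx : x 0 • (s • u + t • w) + x 1 • w + x 2 • eval w F • e + x 3 • f =
        (x 2 * eval w F) • e + x 3 • f + (x 0 • (s • u + t • w) + x 1 • w) := by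
      module
    rw [hx, eval_hyperbolic_add hF he hf (by rw [hcomb]; exact hean _ _)
      (by rw [hcomb]; exact hfan _ _), hval, hef, eval_ellipticForm]
    ring

/-- A quadric without lines that has a nonsingular rational point has dimension at most two. -/
theorem dim_le_two_of_quadric {n : ℕ} {F : MvPolynomial (Fin (n + 2)) K}
    (hF : F.IsHomogeneous 2) (hline : ¬ ContainsLine F) {e : Fin (n + 2) → K}
    (he : eval e F = 0) (hL : polar F e ≠ 0) : n ≤ 2 := by
  by_contra! hn
  obtain ⟨f, hf, hef⟩ := exists_hyperbolic_pair hF he hL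
  obtain ⟨v, hv, hvo⟩ := exists_linearIndependent_orthogonal (k := 3) (by omega) F e f
  let A : (Fin 3 → K) →ₗ[K] (Fin (n + 2) → K) := Fintype.linearCombination K v
  -- Three independent vectors orthogonal to `e, f` carry a ternary quadratic form, which has a
  -- nontrivial zero.
  obtain ⟨x, hx0, hx⟩ := exists_ne_zero_eval_eq_zero (isHomogeneous_pullback A hF)
    (by norm_num) (by norm_num)
  rw [eval_pullback] at hx
  have hAx : A x = ∑ i, x i • v i := Fintype.linearCombination_apply K v x
  refine eval_ne_zero_of_orthogonal hF hline he hef ?_ ?_ ?_ hx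
  · rw [hAx, map_sum]
    exact Finset.sum_eq_zero fun i _ => by rw [map_smul, (hvo i).1, smul_zero]
  · rw [hAx, map_sum]
    exact Finset.sum_eq_zero fun i _ => by rw [map_smul, (hvo i).2, smul_zero]
  · rw [hAx]
    intro h0
    exact hx0 (funext (Fintype.linearIndependent_iff.1 hv x h0))

/-- Chevalley–Warning provides a point, and the partial derivatives `2Xᵢ` have no common zero. -/
lemma sumSqConic_projEquiv_hypConic (hodd : Odd (Fintype.card K)) :
    ProjEquiv (sumSqConic K) (hypConic K) := by
  have h2 := two_ne_zero_of_odd hodd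
  obtain ⟨e, he0, he⟩ := exists_ne_zero_eval_eq_zero (isHomogeneous_sumSqConic (K := K))
    (by norm_num) (by norm_num)
  refine projEquiv_hypConic (n := 1) rfl isHomogeneous_sumSqConic (fun x hx0 _ hL => hx0 ?_) he0 he
  ext i
  have h1 := LinearMap.congr_fun hL (Pi.single i 1)
  rw [polar_apply] at h1
  fin_cases i <;>
    simpa [sumSqConic, pderiv_X, Fin.sum_univ_three, Pi.single_apply, h2] using h1

end Finite

end Hypersurface

end

/-! ### The main theorem. -/

theorem theorem2 {K : Type*} [Field K] [Fintype K] (n d : ℕ) (hn : 1 ≤ n) (hd : 2 ≤ d)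
    (F : MvPolynomial (Fin (n + 2)) K) (hF0 : F ≠ 0) (hF : F.IsHomogeneous d)
    (hline : ¬ Hypersurface.ContainsLine F) :
    Hypersurface.numPoints F ≤
        (d - 1) * Fintype.card K ^ n + (d - 2) * Nat.card (ℙ K (Fin n → K)) + 1 ∧
    (Hypersurface.numPoints F =
        (d - 1) * Fintype.card K ^ n + (d - 2) * Nat.card (ℙ K (Fin n → K)) + 1 ↔
      d = 2 ∧
        ((n = 1 ∧
            ((Odd (Fintype.card K) ∧
                Hypersurface.ProjEquiv F (Hypersurface.sumSqConic K)) ∨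
              (Even (Fintype.card K) ∧
                Hypersurface.ProjEquiv F (Hypersurface.hypConic K)))) ∨
          (n = 2 ∧ ∃ α : K, Hypersurface.IsEllipticParam α ∧
            Hypersurface.ProjEquiv F (Hypersurface.ellipticForm α)))) ∧
    (Hypersurface.numPoints F =
        (d - 1) * Fintype.card K ^ n + (d - 2) * Nat.card (ℙ K (Fin n → K)) + 1 →
      Hypersurface.IsNonsingular F) ∧
    (∀ α : K, Hypersurface.IsEllipticParam α → Irreducible (Hypersurface.binaryForm α)) := by
  change Hypersurface.numPoints F ≤ Hypersurface.pointBound K n d ∧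
    (Hypersurface.numPoints F = Hypersurface.pointBound K n d ↔ _) ∧
    (Hypersurface.numPoints F = Hypersurface.pointBound K n d → _) ∧ _
  -- The conic model `X₀X₁ + X₂²` serves every characteristic here; for odd `q` it is exchanged for
  -- the sum of squares afterwards.
  have hclass : Hypersurface.numPoints F = Hypersurface.pointBound K n d → d = 2 ∧
      (n = 1 ∧ Hypersurface.ProjEquiv F (Hypersurface.hypConic K) ∨
        n = 2 ∧ ∃ α : K, Hypersurface.IsEllipticParam α ∧
          Hypersurface.ProjEquiv F (Hypersurface.ellipticForm α)) := by
    intro heq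
    have hd2 := Hypersurface.degree_eq_two_of_eq hn hF hd hline heq
    subst hd2
    have hns : ∀ x : Fin (n + 2) → K, x ≠ 0 → MvPolynomial.eval x F = 0 →
        Hypersurface.polar F x ≠ 0 := fun x hx0 hx =>
      Hypersurface.polar_ne_zero_of_eq hF hd hline heq hx0 hx
    obtain ⟨e, he0, he⟩ := Hypersurface.exists_zero_of_numPoints_ne_zero
      (show Hypersurface.numPoints F ≠ 0 by rw [heq, Hypersurface.pointBound]; omega)
    have hn2 := Hypersurface.dim_le_two_of_quadric hF hline he (hns e he0 he)
    refine ⟨rfl, ?_⟩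
    rcases (by omega : n = 1 ∨ n = 2) with h1 | h2
    · exact Or.inl ⟨h1, Hypersurface.projEquiv_hypConic h1 hF hns he0 he⟩
    · exact Or.inr ⟨h2,
        Hypersurface.exists_projEquiv_ellipticForm h2 hF hline he (hns e he0 he)⟩
  refine ⟨Hypersurface.numPoints_le_pointBound hF hd hline, ⟨fun heq => ?_, ?_⟩, fun heq => ?_,
    fun α hα => Hypersurface.irreducible_binaryForm hα⟩
  · obtain ⟨rfl, ⟨h1, hconic⟩ | h2⟩ := hclass heq
    · refine ⟨rfl, Or.inl ⟨h1, ?_⟩⟩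
      rcases Nat.even_or_odd (Fintype.card K) with heven | hodd
      · exact Or.inr ⟨heven, hconic⟩
      · exact Or.inl ⟨hodd, hconic.trans_of_quadric hF Hypersurface.isHomogeneous_sumSqConic
          ((Hypersurface.sumSqConic_projEquiv_hypConic hodd).symm_of_quadric
            Hypersurface.isHomogeneous_sumSqConic Hypersurface.isHomogeneous_hypConic)⟩
    · exact ⟨rfl, Or.inr h2⟩
  · rintro ⟨rfl, hforms⟩
    have hpt : ∃ x : Fin (n + 2) → K, x ≠ 0 ∧ MvPolynomial.eval x F = 0 ∧
        Hypersurface.polar F x ≠ 0 := by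
      have hhyp : Hypersurface.ProjEquiv F (Hypersurface.hypConic K) →
          ∃ x : Fin (n + 2) → K, x ≠ 0 ∧ MvPolynomial.eval x F = 0 ∧
            Hypersurface.polar F x ≠ 0 := fun h =>
        h.exists_nonsingular_point hF (y := ![1, 0, 0]) (z := ![0, 1, 0])
          (by simp [Hypersurface.eval_hypConic]) (by simp [Hypersurface.eval_hypConic])
          (by simp [Hypersurface.eval_hypConic])
      obtain ⟨-, ⟨hodd, h⟩ | ⟨-, h⟩⟩ | ⟨-, α, -, h⟩ := hforms
      · exact hhyp (h.trans_of_quadric hF Hypersurface.isHomogeneous_hypConic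
          (Hypersurface.sumSqConic_projEquiv_hypConic hodd))
      · exact hhyp h
      · exact h.exists_nonsingular_point hF (y := ![0, 0, 1, 0]) (z := ![0, 0, 0, 1])
          (by simp [Hypersurface.eval_ellipticForm]) (by simp [Hypersurface.eval_ellipticForm])
          (by simp [Hypersurface.eval_ellipticForm])
    obtain ⟨x, hx0, hx, hL⟩ := hpt
    exact Hypersurface.numPoints_eq_of_quadric hF hline hx0 hx hL
  · obtain ⟨-, ⟨-, h⟩ | ⟨-, α, hα, h⟩⟩ := hclass heq
    · exact h.isNonsingular Hypersurface.isNonsingular_hypConic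
    · exact h.isNonsingular
        (Hypersurface.isNonsingular_ellipticForm (Hypersurface.one_sub_four_mul_ne_zero hα))
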